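/- Let $n\ge 1$, let $D\subseteq\mathbb R^n$ be a domain that is either $\mathbb R^n$ or bounded with $C^2$-smooth boundary, let $T>0$ and $Q=D\times(0,T)$. Let $H^0=L_2(D)$, let $H^1$ be the closure of $C_c^\infty(D)$ in $W^1_2(D)$, and let $H^{-1}$ be the dual of $H^1$. Consider $$\frac{\partial u}{\partial t}=\nabla\cdot(b\nabla u)+f\cdot\nabla u+\lambda u+\nabla\cdot F+F_0\ \text{ in } Q,\qquad u(\cdot,0)=0,\qquad u|_{\partial D}=0,\tag{1}$$ where $b=b^\top$, $f$, $\lambda$ are measurable functions of $(x,t)$ with values in $\mathbb R^{n\times n}$, $\mathbb R^n$, $\mathbb R$, with $\operatorname{ess\,sup}_Q(|b|+|b^{-1}|+|f|+|\lambda|)<\infty$ and $\xi^\top b(x,t)\xi\ge\delta|\xi|^2$ for all $\xi\in\mathbb R^n$, $(x,t)\in Q$, for a constant $\delta>0$ ($|\cdot|$ is the Frobenius norm for matrices). Call $\mu=(T,n,D,\delta,b,f,\lambda)$ with these properties admissible and put $\mathcal P(\mu)=\bigl(T,n,D,\delta,\operatorname{ess\,sup}_Q(|b|+|f|+|\lambda|)\bigr)$.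 The components of $F$ and $F_0$ are in $L_2(Q)$, and a solution of (1) is a function $u\in L^2([0,T];H^1)\cap C([0,T];H^0)$ such that, for every $t\in[0,T]$, the equation integrated over $[0,t]$ holds as an equality in $H^{-1}$. For $K\in\mathbb R$, $M\ge 0$ and a given value $\mathcal P$, let $C_1(K,M,\mathcal P)$ be the infimum of all $\tilde C_1>0$ for which there is $\tilde C_0>0$ such that, for every admissible $\mu$ with $\mathcal P(\mu)=\mathcal P$, all $F,F_0$ as above, the solution $u$ of (1) and all $t\in(0,T]$, $$e^{-2Kt}\|u(\cdot,t)\|_{H^0}^2+M\int_0^te^{-2Ks}\|u(\cdot,s)\|_{H^0}^2ds\le \tilde C_1\int_0^te^{-2Ks}\bigl(F(\cdot,s),b(\cdot,s)^{-1}F(\cdot,s)\bigr)_{H^0}ds+\tilde C_0\int_0^te^{-2Ks}\|F_0(\cdot,s)\|^2_{H^0}ds .$$ Theorem. Let $n=1$, $D=(-\pi,\pi)$, $b\equiv1$, $f\equiv0$, $\lambda\equiv0$, and let $0<\delta\le1$. Then, for every $T>0$ and $M\ge0$, the data $\mu=(T,n,D,\delta,b,f,\lambda)$ are admissible and $$\inf_{K\ge0}C_1(K,M,\mathcal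 P(\mu))=\frac12 .$$ -/

import Mathlib

open MeasureTheory Set Filter Topology
open scoped ENNReal NNReal ContDiff

noncomputable section

namespace ParabolicSharp

/-- Euclidean space `ℝⁿ`. -/
abbrev E (n : ℕ) : Type := EuclideanSpace ℝ (Fin n)

/-- The product of a matrix with a vector of `ℝⁿ`. -/
def mulVecE {n : ℕ} (A : Matrix (Fin n) (Fin n) ℝ) (v : E n) : E n :=
  WithLp.toLp 2 (A.mulVec v.ofLp)

/-- The Frobenius norm of a matrix. -/
def frob {n : ℕ} (A : Matrix (Fin n) (Fin n) ℝ) : ℝ :=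
  Real.sqrt (∑ i, ∑ j, A i j ^ 2)

/-- The boundary of `D` is `C²`-smooth: near each of its boundary points `D` is a strict sublevel
set of a `C²` function with nonvanishing differential at that point. -/
def HasC2Boundary {n : ℕ} (D : Set (E n)) : Prop :=
  ∀ x ∈ frontier D, ∃ (U : Set (E n)) (ρ : E n → ℝ), IsOpen U ∧ x ∈ U ∧
    ContDiffOn ℝ 2 ρ U ∧ fderiv ℝ ρ x ≠ 0 ∧ D ∩ U = {y ∈ U | ρ y < 0}

/-- The domains under consideration: the whole space, or a bounded domain with `C²` boundary. -/
def AdmissibleDomain {n : ℕ} (D : Set (E n)) : Prop :=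
  0 < n ∧ IsOpen D ∧ IsConnected D ∧
    (D = univ ∨ (Bornology.IsBounded D ∧ HasC2Boundary D))

/-- The data `μ = (T, n, D, δ, b, f, λ)` of a first boundary value problem in `(0,T) × D` for
`∂u/∂t = ∇·(b∇u) + f·∇u + λu + φ`. The coefficients are written as functions of `t`, then `x`. -/
structure Params (n : ℕ) where
  T : ℝ
  D : Set (E n)
  δ : ℝ
  b : ℝ → E n → Matrix (Fin n) (Fin n) ℝ
  f : ℝ → E n → E n
  lam : ℝ → E n → ℝ

/-- The collection `𝒫 = (T, n, D, δ, ess sup (|b| + |f| + |λ|))`. -/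
@[ext] structure ParamClass (n : ℕ) where
  T : ℝ
  D : Set (E n)
  δ : ℝ
  bound : ℝ≥0∞

namespace Params

variable {n : ℕ}

/-- The space-time cylinder. -/
def Q (μ : Params n) : Set (ℝ × E n) := Ioo 0 μ.T ×ˢ μ.D

/-- The collection `𝒫(μ)`. -/
def P (μ : Params n) : ParamClass n where
  T := μ.T
  D := μ.D
  δ := μ.δ
  bound := essSup
    (fun p : ℝ × E n =>
      ENNReal.ofReal (frob (μ.b p.1 p.2) + ‖μ.f p.1 p.2‖ + |μ.lam p.1 p.2|))
    (volume.restrict μ.Q)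

/-- The standing assumptions: an admissible domain, measurable essentially bounded coefficients
(with `b⁻¹` essentially bounded), and a symmetric, uniformly coercive matrix `b`. -/
structure Admissible (μ : Params n) : Prop where
  T_pos : 0 < μ.T
  domain : AdmissibleDomain μ.D
  δ_pos : 0 < μ.δ
  symm : ∀ p ∈ μ.Q, (μ.b p.1 p.2).IsSymm
  coercive : ∀ p ∈ μ.Q, ∀ ξ : E n, μ.δ * ‖ξ‖ ^ 2 ≤ inner ℝ ξ (mulVecE (μ.b p.1 p.2) ξ)
  b_meas : ∀ i j, AEMeasurable (fun p : ℝ × E n => μ.b p.1 p.2 i j) (volume.restrict μ.Q)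
  f_meas : AEMeasurable (fun p : ℝ × E n => μ.f p.1 p.2) (volume.restrict μ.Q)
  lam_meas : AEMeasurable (fun p : ℝ × E n => μ.lam p.1 p.2) (volume.restrict μ.Q)
  bounded : essSup
    (fun p : ℝ × E n =>
      ENNReal.ofReal (frob (μ.b p.1 p.2) + frob (μ.b p.1 p.2)⁻¹ + ‖μ.f p.1 p.2‖
        + |μ.lam p.1 p.2|))
    (volume.restrict μ.Q) < ⊤

end Params

variable {n : ℕ}

/-- Smooth functions with compact support in `D`. -/
def IsTest (D : Set (E n)) (ψ : E n → ℝ) : Prop :=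
  ContDiff ℝ ∞ ψ ∧ HasCompactSupport ψ ∧ tsupport ψ ⊆ D

/-- `v` belongs to `H¹`, the closure of the test functions in the norm of `W₂¹(D)`, and `g` is its
gradient. -/
def MemH1 (D : Set (E n)) (v : E n → ℝ) (g : E n → E n) : Prop :=
  MemLp v 2 (volume.restrict D) ∧ MemLp g 2 (volume.restrict D) ∧
    ∃ ψ : ℕ → E n → ℝ, (∀ k, IsTest D (ψ k)) ∧
      Tendsto (fun k => eLpNorm (fun x => v x - ψ k x) 2 (volume.restrict D)) atTop (𝓝 0) ∧
      Tendsto (fun k => eLpNorm (fun x => g x - gradient (ψ k) x) 2 (volume.restrict D))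
        atTop (𝓝 0)

/-- `u ∈ X¹ = L²([0,T]; H¹)`, with spatial gradient `g`. -/
def MemX1 (T : ℝ) (D : Set (E n)) (u : ℝ → E n → ℝ) (g : ℝ → E n → E n) : Prop :=
  MemLp (fun p : ℝ × E n => u p.1 p.2) 2 (volume.restrict (Ioo 0 T ×ˢ D)) ∧
  MemLp (fun p : ℝ × E n => g p.1 p.2) 2 (volume.restrict (Ioo 0 T ×ˢ D)) ∧
  ∀ᵐ t ∂(volume.restrict (Ioo 0 T)), MemH1 D (u t) (g t)

/-- `u ∈ 𝒞⁰ = C([0,T]; L²(D))`. -/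
def MemC0 (T : ℝ) (D : Set (E n)) (u : ℝ → E n → ℝ) : Prop :=
  (∀ t ∈ Icc 0 T, MemLp (u t) 2 (volume.restrict D)) ∧
  ∀ t ∈ Icc 0 T, Tendsto (fun s => eLpNorm (fun x => u s x - u t x) 2 (volume.restrict D))
    (𝓝[Icc 0 T] t) (𝓝 0)

/-- `u ∈ Y¹ = X¹ ∩ 𝒞⁰` (with spatial gradient `g`) is the solution of
`∂u/∂t = ∇·(b∇u) + f·∇u + λu + ∇·F + F₀` in `(0,T) × D` with `u(·,0) = 0` and `u = 0` on `∂D`: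
`u(t) = ∫₀ᵗ (𝒜u + φ) ds` as an equality in `H⁻¹`, tested against smooth functions with
compact support, which are dense in `H¹`. -/
structure IsSolution (μ : Params n) (F : ℝ → E n → E n) (F₀ : ℝ → E n → ℝ)
    (u : ℝ → E n → ℝ) (g : ℝ → E n → E n) : Prop where
  memX1 : MemX1 μ.T μ.D u g
  memC0 : MemC0 μ.T μ.D u
  init : ∀ᵐ x ∂(volume.restrict μ.D), u 0 x = 0
  eqn : ∀ t ∈ Icc 0 μ.T, ∀ ψ : E n → ℝ, IsTest μ.D ψ →
    ∫ x in μ.D, u t x * ψ x =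
      ∫ s in (0 : ℝ)..t, ∫ x in μ.D,
        (- inner ℝ (mulVecE (μ.b s x) (g s x)) (gradient ψ x)
          + inner ℝ (μ.f s x) (g s x) * ψ x + μ.lam s x * u s x * ψ x
          - inner ℝ (F s x) (gradient ψ x) + F₀ s x * ψ x)

/-- The energy estimate with constants `c₁`, `c₀` for all free terms `φ = ∇·F + F₀ ∈ X⁻¹`, that is,
for all `F`, `F₀` with components in `X⁰ = L²((0,T) × D)`, and all `t ∈ (0,T]`. -/
def EnergyEstimate (μ : Params n) (K M c₁ c₀ : ℝ) : Prop :=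
  ∀ (F : ℝ → E n → E n) (F₀ : ℝ → E n → ℝ),
    MemLp (fun p : ℝ × E n => F p.1 p.2) 2 (volume.restrict μ.Q) →
    MemLp (fun p : ℝ × E n => F₀ p.1 p.2) 2 (volume.restrict μ.Q) →
    ∀ (u : ℝ → E n → ℝ) (g : ℝ → E n → E n), IsSolution μ F F₀ u g →
    ∀ t ∈ Ioc 0 μ.T,
      Real.exp (-2 * K * t) * (∫ x in μ.D, u t x ^ 2)
          + M * ∫ s in (0 : ℝ)..t, Real.exp (-2 * K * s) * ∫ x in μ.D, u s x ^ 2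
        ≤ c₁ * (∫ s in (0 : ℝ)..t, Real.exp (-2 * K * s) *
              ∫ x in μ.D, inner ℝ (F s x) (mulVecE (μ.b s x)⁻¹ (F s x)))
          + c₀ * ∫ s in (0 : ℝ)..t, Real.exp (-2 * K * s) * ∫ x in μ.D, F₀ s x ^ 2

/-- The constant `C₁(K, M, 𝒫)`: the infimum of all `c₁ > 0` that occur, with some `c₀ > 0`, as a
pair of constants in the energy estimate; these constants may depend on `K`, `M` and `𝒫` only, so
they serve all admissible `μ` with `𝒫(μ) = 𝒫`. The value is `∞` if there is no such `c₁`. -/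
def C₁ (K M : ℝ) (P : ParamClass n) : ℝ≥0∞ :=
  sInf {c : ℝ≥0∞ | ∃ c₁ c₀ : ℝ, 0 < c₁ ∧ 0 < c₀ ∧ c = ENNReal.ofReal c₁ ∧
    ∀ μ : Params n, μ.Admissible → μ.P = P → EnergyEstimate μ K M c₁ c₀}

/-- The data `n = 1`, `D = (-π, π)`, `b ≡ 1`, `f ≡ 0`, `λ ≡ 0`. -/
def heatParams (T δ : ℝ) : Params 1 where
  T := T
  D := {x | x 0 ∈ Ioo (-Real.pi) Real.pi}
  δ := δ
  b := fun _ _ => 1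
  f := fun _ _ => 0
  lam := fun _ _ => 0

end ParabolicSharp

end

/-! Upper bound. Formally, twice the pairing of the equation with `u` gives the derivative of ‖u‖².
For `a < 1`, Young's inequality in the metric of `b` splits the free term: -2(F,∇u) ≤
(1/(2a))(F,b⁻¹F) + 2a(b∇u,∇u). The share 2(1-a)(b∇u,∇u) of the dissipation that is left absorbs the
drift, and the weight e^{-2Ks} with `K` large absorbs every multiple of ‖u‖²
(`energy_integrand_le`). So 1/(2a) is an admissible constant for a suitable `K` that depends only on
`M`, `a` and the class (`C₁_le`). Letting a → 1 gives 1/2, with `K` allowed to grow.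

Since `u` has no time derivative at hand, the energy inequality is obtained from backward
increments. The weak equation between s-h and s is tested with u(s), and ‖u(s)‖² - ‖u(s-h)‖² ≤
2(u(s)-u(s-h),u(s)) is integrated in s. Continuity of translations in L² then permits h → 0
(`le_two_mul_integral_inner_of_increment_le`, `integral_sq_le_of_weak_formulation`). Only an
inequality is needed, so one-sided increments suffice.

Lower bound. For the heat equation take F = -φ(t)cos(jx), so that u = a(t)sin(jx) with a' = j(φ -
ja). With κ = j² + K, the choice φ = e^{(K+κ)t} maximizes the ratio of the weighted |a(T)|² to the
weighted ∫φ². That maximum is j²(1-e^{-2κT})/(2κ), which tends to 1/2 as j → ∞ for each fixed `K`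
(`EnergyEstimate.half_le`). -/

noncomputable section

namespace ParabolicSharp

/-! ### Pairings of L² functions and their limits. -/

section L2Pairing

variable {X W ι : Type*} [MeasurableSpace X] {ν : Measure X}
  [NormedAddCommGroup W] [InnerProductSpace ℝ W]

theorem integral_inner_eq_inner_toLp {a b : X → W} (ha : MemLp a 2 ν) (hb : MemLp b 2 ν) :
    ∫ x, inner ℝ (a x) (b x) ∂ν = inner ℝ (ha.toLp a) (hb.toLp b) := by
  rw [L2.inner_def]
  refine integral_congr_ae ?_
  filter_upwards [ha.coeFn_toLp, hb.coeFn_toLp] with x h1 h2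
  rw [h1, h2]

theorem integrable_inner_of_memLp {a b : X → W} (ha : MemLp a 2 ν) (hb : MemLp b 2 ν) :
    Integrable (fun x => inner ℝ (a x) (b x)) ν := by
  refine (L2.integrable_inner (𝕜 := ℝ) (ha.toLp a) (hb.toLp b)).congr ?_
  filter_upwards [ha.coeFn_toLp, hb.coeFn_toLp] with x h1 h2
  rw [h1, h2]

theorem tendsto_integral_inner {l : Filter ι} {a b : ι → X → W} {a₀ b₀ : X → W}
    (ha : ∀ i, MemLp (a i) 2 ν) (hb : ∀ i, MemLp (b i) 2 ν)
    (ha₀ : MemLp a₀ 2 ν) (hb₀ : MemLp b₀ 2 ν)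
    (hat : Tendsto (fun i => eLpNorm (a i - a₀) 2 ν) l (𝓝 0))
    (hbt : Tendsto (fun i => eLpNorm (b i - b₀) 2 ν) l (𝓝 0)) :
    Tendsto (fun i => ∫ x, inner ℝ (a i x) (b i x) ∂ν) l
      (𝓝 (∫ x, inner ℝ (a₀ x) (b₀ x) ∂ν)) := by
  have h1 := (Lp.tendsto_Lp_iff_tendsto_eLpNorm'' a ha a₀ ha₀).2 hat
  have h2 := (Lp.tendsto_Lp_iff_tendsto_eLpNorm'' b hb b₀ hb₀).2 hbt
  simp only [integral_inner_eq_inner_toLp (ha _) (hb _), integral_inner_eq_inner_toLp ha₀ hb₀]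
  exact h1.inner h2

end L2Pairing

/-! ### Time translations in L². -/

section Translation

variable {X W : Type*} [NormedAddCommGroup W] [InnerProductSpace ℝ W] [MeasureSpace X]

theorem measurePreserving_sub_fst [SigmaFinite (volume : Measure X)] (θ : ℝ) :
    MeasurePreserving (fun p : ℝ × X => (p.1 - θ, p.2)) volume volume :=
  (measurePreserving_sub_right (volume : Measure ℝ) θ).prod
    (MeasurePreserving.id (volume : Measure X))

/-- Translations act continuously on L², the exponent being finite; shifting time by θ is the action
of (-θ, 0). -/
theorem continuous_integral_inner_translate [NormedAddCommGroup X] [SecondCountableTopology X]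
    [BorelSpace X] [(volume : Measure X).IsAddHaarMeasure] [LocallyCompactSpace X] {A w : ℝ × X → W}
    (hA : MemLp A 2 volume) (hw : MemLp w 2 volume) :
    Continuous (fun θ : ℝ => ∫ p : ℝ × X, inner ℝ (A (p.1 - θ, p.2)) (w p)) := by
  have hcomp : ∀ θ : ℝ, MemLp (fun p : ℝ × X => A (p.1 - θ, p.2)) 2 volume := fun θ =>
    hA.comp_measurePreserving (measurePreserving_sub_fst θ)
  have hHaar : (volume : Measure (ℝ × X)).IsAddHaarMeasure :=
    inferInstanceAs ((volume : Measure ℝ).prod (volume : Measure X)).IsAddHaarMeasure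
  have key : ∀ θ : ℝ, (hcomp θ).toLp _ =
      DomAddAct.mk ((-θ, 0) : ℝ × X) +ᵥ hA.toLp A := by
    intro θ
    rw [DomAddAct.mk_vadd_toLp]
    congr 1
    funext ⟨r, x⟩
    simp [sub_eq_neg_add]
  simp only [integral_inner_eq_inner_toLp (hcomp _) hw, key]
  refine Continuous.inner ?_ continuous_const
  have : Fact ((2 : ℝ≥0∞) ≠ ⊤) := ⟨by simp⟩
  exact continuous_vadd.comp
    ((DomAddAct.continuous_mk.comp (by fun_prop)).prodMk continuous_const)

variable [SigmaFinite (volume : Measure X)]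

/-- The shear (θ, (s, x)) ↦ (θ, (s-θ, x)) preserves the product measure, so the translates of `A`
form one L² function of all the variables. This justifies the later use of Fubini. -/
theorem integrable_inner_translate_prod {A w : ℝ × X → W}
    (hA : MemLp A 2 volume) (hw : MemLp w 2 volume) (h : ℝ) :
    Integrable (fun q : ℝ × (ℝ × X) => inner ℝ (A (q.2.1 - q.1, q.2.2)) (w q.2))
      ((volume.restrict (Ioc 0 h)).prod volume) := by
  have hmp : MeasurePreserving (fun q : ℝ × (ℝ × X) => (q.1, (q.2.1 - q.1, q.2.2)))
      ((volume.restrict (Ioc 0 h)).prod volume) ((volume.restrict (Ioc 0 h)).prod volume) := by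
    refine (MeasurePreserving.id _).skew_product (g := fun (θ : ℝ) (p : ℝ × X) => (p.1 - θ, p.2)) ?_ ?_
    · fun_prop
    · exact Eventually.of_forall fun θ => (measurePreserving_sub_fst θ).map_eq
  have h1 := (hA.comp_snd (volume.restrict (Ioc (0:ℝ) h))).comp_measurePreserving hmp
  exact integrable_inner_of_memLp h1 (hw.comp_snd _)

theorem integrable_integral_inner_translate {A w : ℝ × X → W}
    (hA : MemLp A 2 volume) (hw : MemLp w 2 volume) (h : ℝ) :
    Integrable (fun q : ℝ × ℝ => ∫ x, inner ℝ (A (q.2 - q.1, x)) (w (q.2, x)))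
      ((volume.restrict (Ioc 0 h)).prod volume) := by
  have h1 := (integrable_inner_translate_prod hA hw h)
  have h2 := (measurePreserving_prodAssoc (volume.restrict (Ioc (0:ℝ) h)) (volume : Measure ℝ)
    (volume : Measure X)).integrable_comp_of_integrable (g := fun q : ℝ × (ℝ × X) =>
      inner ℝ (A (q.2.1 - q.1, q.2.2)) (w q.2)) h1
  exact h2.integral_prod_left

theorem integral_integral_inner_translate {A w : ℝ × X → W}
    (hA : MemLp A 2 volume) (hw : MemLp w 2 volume) (h : ℝ) :
    ∫ s, ∫ θ in Ioc 0 h, ∫ x, inner ℝ (A (s - θ, x)) (w (s, x)) =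
      ∫ θ in Ioc 0 h, ∫ p : ℝ × X, inner ℝ (A (p.1 - θ, p.2)) (w p) := by
  rw [← integral_integral_swap (integrable_integral_inner_translate hA hw h)]
  refine integral_congr_ae (Eventually.of_forall fun θ => ?_)
  exact (integral_prod _ (integrable_inner_of_memLp
    (hA.comp_measurePreserving (measurePreserving_sub_fst θ)) hw)).symm

end Translation

/-! ### The limit of backward increments, and the exponential weight. -/

section EnergyAbstract

/-- Integrating `hinc` over (0,t] telescopes the left side to the integral of `y` over the last
stretch of length `h`. By Fubini the right side becomes an average of translated pairings F(θ) over
θ in (0,h]. Division by `h` and h → 0 leave y(t) ≤ 2F(0). -/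
theorem le_two_mul_integral_inner_of_increment_le {X W : Type*} [NormedAddCommGroup W]
    [InnerProductSpace ℝ W]
    [MeasureSpace X] [NormedAddCommGroup X] [SecondCountableTopology X]
    [BorelSpace X] [(volume : Measure X).IsAddHaarMeasure] [LocallyCompactSpace X]
    {A w : ℝ × X → W} (hA : MemLp A 2 volume) (hw : MemLp w 2 volume) {t : ℝ} (ht : 0 < t)
    (hw0 : ∀ s x, s ∉ Ioc 0 t → w (s, x) = 0) {y : ℝ → ℝ} (hy0 : ∀ s ≤ 0, y s = 0)
    (hyI : IntervalIntegrable y volume (-t) t) (hyc : ContinuousWithinAt y (Iic t) t)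
    (hinc : ∀ h ∈ Ioo 0 t, ∀ᵐ s, s ∈ Ioc 0 t → y s - y (s - h) ≤
      2 * ∫ θ in Ioc 0 h, ∫ x, inner ℝ (A (s - θ, x)) (w (s, x))) :
    y t ≤ 2 * ∫ p, inner ℝ (A p) (w p) := by
  set F : ℝ → ℝ := fun θ => ∫ p : ℝ × X, inner ℝ (A (p.1 - θ, p.2)) (w p) with hF
  have hFc : Continuous F := continuous_integral_inner_translate hA hw
  have hF0 : F 0 = ∫ p, inner ℝ (A p) (w p) := by simp [hF]
  have sub : ∀ a b, a ∈ Icc (-t) t → b ∈ Icc (-t) t → IntervalIntegrable y volume a b := by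
    intro a b ha hb
    refine hyI.mono_set ?_
    rw [uIcc_of_le (by linarith : -t ≤ t)]
    exact uIcc_subset_Icc ha hb
  have main : ∀ h ∈ Ioo 0 t, ∫ s in (t - h)..t, y s ≤ 2 * ∫ θ in Ioc 0 h, F θ := by
    intro h hh
    have hsh : IntervalIntegrable (fun s => y (s - h)) volume 0 t := by
      have := (sub (-h) (t - h) ⟨by linarith [hh.2], by linarith [hh.1]⟩
        ⟨by linarith [hh.2], by linarith [hh.1]⟩).comp_sub_right h
      simpa using this
    have h0t := sub 0 t ⟨by linarith, ht.le⟩ ⟨by linarith, le_rfl⟩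
    have e1 : ∫ s in (t - h)..t, y s = ∫ s in (0:ℝ)..t, (y s - y (s - h)) := by
      rw [intervalIntegral.integral_sub h0t hsh,
        intervalIntegral.integral_comp_sub_right (fun s => y s)]
      have z : ∫ s in (0 - h)..0, y s = 0 := by
        rw [intervalIntegral.integral_of_le (by linarith [hh.1])]
        exact setIntegral_eq_zero_of_forall_eq_zero fun s hs => hy0 s hs.2
      have a1 := intervalIntegral.integral_add_adjacent_intervals
        (sub (0 - h) 0 ⟨by linarith [hh.2], by linarith [hh.1]⟩ ⟨by linarith, ht.le⟩)
        (sub 0 (t - h) ⟨by linarith, ht.le⟩ ⟨by linarith [hh.2], by linarith [hh.1]⟩)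
      have a2 := intervalIntegral.integral_add_adjacent_intervals
        (sub 0 (t - h) ⟨by linarith, ht.le⟩ ⟨by linarith [hh.2], by linarith [hh.1]⟩)
        (sub (t - h) t ⟨by linarith [hh.2], by linarith [hh.1]⟩ ⟨by linarith, le_rfl⟩)
      linarith
    have hint : Integrable (fun s => ∫ θ in Ioc 0 h, ∫ x, inner ℝ (A (s - θ, x)) (w (s, x))) :=
      (integrable_integral_inner_translate hA hw h).integral_prod_right
    rw [e1, intervalIntegral.integral_of_le ht.le, ← integral_integral_inner_translate hA hw h,
      ← integral_const_mul]
    -- Passing from (0,t] to the whole line costs nothing, because `w` vanishes off (0,t].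
    rw [← setIntegral_eq_integral_of_forall_compl_eq_zero (s := Ioc 0 t)
      (f := fun s => 2 * ∫ θ in Ioc 0 h, ∫ x, inner ℝ (A (s - θ, x)) (w (s, x)))]
    · refine setIntegral_mono_on_ae (h0t.sub hsh).1 (hint.const_mul 2).integrableOn
        measurableSet_Ioc (hinc h hh)
    · intro s hs
      simp [hw0 s _ hs]
  rw [← hF0]
  -- The left side loses ε/3 and the right side loses 2·(ε/3).
  refine le_of_forall_pos_le_add fun ε hε => ?_
  obtain ⟨η₁, hη₁, h1⟩ := Metric.continuousWithinAt_iff.1 hyc (ε / 3) (by positivity)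
  obtain ⟨η₂, hη₂, h2⟩ := Metric.continuousAt_iff.1 (hFc.continuousAt (x := 0)) (ε / 3)
    (by positivity)
  set h := min (min η₁ η₂) t / 2 with hh
  have hm : 0 < min (min η₁ η₂) t := by positivity
  have hpos : 0 < h := by positivity
  have hl1 : h < η₁ := by
    have := (min_le_left (min η₁ η₂) t).trans (min_le_left _ _); linarith
  have hl2 : h < η₂ := by
    have := (min_le_left (min η₁ η₂) t).trans (min_le_right _ _); linarith
  have hl3 : h < t := by
    have := (min_le_right (min η₁ η₂) t); linarith
  have b1 : h * (y t - ε / 3) ≤ ∫ s in (t - h)..t, y s := by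
    have : ∫ s in (t - h)..t, (y t - ε / 3) ≤ ∫ s in (t - h)..t, y s := by
      refine intervalIntegral.integral_mono_on (by linarith) (by simp)
        (sub (t - h) t ⟨by linarith, by linarith⟩ ⟨by linarith, le_rfl⟩) fun s hs => ?_
      have := h1 (x := s) hs.2 (by rw [Real.dist_eq, abs_lt]; constructor <;> linarith [hs.1, hs.2])
      rw [Real.dist_eq, abs_lt] at this
      linarith [this.1]
    rwa [intervalIntegral.integral_const, sub_sub_cancel, smul_eq_mul] at this
  have b2 : ∫ θ in Ioc 0 h, F θ ≤ h * (F 0 + ε / 3) := by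
    rw [← intervalIntegral.integral_of_le hpos.le]
    have : ∫ s in (0:ℝ)..h, F s ≤ ∫ s in (0:ℝ)..h, (F 0 + ε / 3) := by
      refine intervalIntegral.integral_mono_on hpos.le (hFc.intervalIntegrable _ _)
        (by simp) fun s hs => ?_
      have := h2 (x := s) (by rw [Real.dist_eq, abs_lt]; constructor <;> linarith [hs.1, hs.2])
      rw [Real.dist_eq, abs_lt] at this
      linarith [this.2]
    rwa [intervalIntegral.integral_const, sub_zero, smul_eq_mul] at this
  have b3 := main h ⟨hpos, hl3⟩
  have : h * (y t - ε / 3) ≤ h * (2 * (F 0 + ε / 3)) := by linarith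
  have := le_of_mul_le_mul_left this hpos
  linarith

/-- The majorant Y(s) = ∫₀ˢ a is absolutely continuous, so e^{-2Ks}Y can be differentiated and
integrated back even though `y` may not be differentiable. Since K ≥ 0, replacing -2KY by -2Ky only
increases the integral. -/
theorem exp_mul_le_integral_of_le_integral {K t : ℝ} (hK : 0 ≤ K) (ht : 0 ≤ t) {a y : ℝ → ℝ}
    (ha : IntervalIntegrable a volume 0 t) (hy : IntervalIntegrable y volume 0 t)
    (hle : ∀ s ∈ Icc 0 t, y s ≤ ∫ r in (0:ℝ)..s, a r) :
    Real.exp (-2 * K * t) * y t ≤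
      ∫ s in (0:ℝ)..t, Real.exp (-2 * K * s) * (a s - 2 * K * y s) := by
  set Y : ℝ → ℝ := fun s => ∫ r in (0:ℝ)..s, a r with hY
  have hYac : AbsolutelyContinuousOnInterval Y 0 t :=
    ha.absolutelyContinuousOnInterval_intervalIntegral (by simp)
  have hexp : ContDiff ℝ 1 (fun s : ℝ => Real.exp (-2 * K * s)) := by fun_prop
  have key := AbsolutelyContinuousOnInterval.integral_deriv_mul_eq_sub
    (hexp.contDiffOn.absolutelyContinuousOnInterval (a := 0) (b := t)) hYac
  have hY0 : Y 0 = 0 := by simp [hY]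
  have hexpc : ContinuousOn (fun s : ℝ => Real.exp (-2 * K * s)) (uIcc 0 t) :=
    hexp.continuous.continuousOn
  have e : ∫ s in (0:ℝ)..t, Real.exp (-2 * K * s) * (a s - 2 * K * Y s) =
      Real.exp (-2 * K * t) * Y t := by
    rw [hY0, mul_zero, sub_zero] at key
    rw [← key]
    refine intervalIntegral.integral_congr_ae ?_
    filter_upwards [ha.ae_hasDerivAt_integral] with s hs hs'
    have d1 : HasDerivAt (fun s : ℝ => Real.exp (-2 * K * s))
        (Real.exp (-2 * K * s) * (-2 * K)) s := by
      simpa using ((hasDerivAt_id s).const_mul (-2 * K)).exp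
    rw [d1.deriv, (hs (uIoc_subset_uIcc hs') 0 (by simp)).deriv]
    ring
  have hYI : IntervalIntegrable Y volume 0 t := hYac.continuousOn.intervalIntegrable
  calc _ ≤ Real.exp (-2 * K * t) * Y t := by
        gcongr; exact hle t ⟨ht, le_rfl⟩
    _ = _ := e.symm
    _ ≤ _ := by
      refine intervalIntegral.integral_mono_on ht
        ((ha.sub (hYI.const_mul (2 * K))).continuousOn_mul hexpc)
        ((ha.sub (hy.const_mul (2 * K))).continuousOn_mul hexpc) fun s hs => ?_
      have := hle s hs
      gcongr

end EnergyAbstract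

/-! ### Weak formulation tested with H¹ functions, and the energy inequality. -/

variable {n : ℕ}

/-- The value and the gradient of a function, as one vector. -/
abbrev Jet (n : ℕ) : Type := WithLp 2 (ℝ × E n)

/-- The vector with the given components. -/
def jet (a : ℝ) (v : E n) : Jet n := WithLp.toLp 2 (a, v)

theorem inner_jet (a b : ℝ) (v w : E n) :
    inner ℝ (jet a v) (jet b w) = inner ℝ v w + a * b := by
  rw [WithLp.prod_inner_apply]
  simp [jet, add_comm, mul_comm]

theorem norm_jet_le (a : ℝ) (v : E n) : ‖jet a v‖ ≤ ‖a‖ + ‖v‖ := by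
  have h := WithLp.prod_norm_sq_eq_of_L2 (jet a v)
  simp only [jet, WithLp.toLp_fst, WithLp.toLp_snd] at h ⊢
  nlinarith [norm_nonneg a, norm_nonneg v, mul_nonneg (norm_nonneg a) (norm_nonneg v),
    norm_nonneg (WithLp.toLp 2 (a, v))]

theorem memLp_jet {X : Type*} [MeasurableSpace X] {ν : Measure X} {a : X → ℝ} {v : X → E n}
    (ha : MemLp a 2 ν) (hv : MemLp v 2 ν) : MemLp (fun x => jet (a x) (v x)) 2 ν :=
  memLp_prodLp_iff.2 ⟨ha, hv⟩

theorem tendsto_eLpNorm_jet {X ι : Type*} [MeasurableSpace X] {ν : Measure X} {l : Filter ι}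
    {a : ι → X → ℝ} {v : ι → X → E n}
    (ham : ∀ i, AEStronglyMeasurable (a i) ν) (hvm : ∀ i, AEStronglyMeasurable (v i) ν)
    (ha : Tendsto (fun i => eLpNorm (a i) 2 ν) l (𝓝 0))
    (hv : Tendsto (fun i => eLpNorm (v i) 2 ν) l (𝓝 0)) :
    Tendsto (fun i => eLpNorm (fun x => jet (a i x) (v i x)) 2 ν) l (𝓝 0) := by
  refine tendsto_of_tendsto_of_tendsto_of_le_of_le tendsto_const_nhds
    (by simpa using ha.add hv) (fun _ => zero_le) fun i => ?_
  calc eLpNorm (fun x => jet (a i x) (v i x)) 2 ν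
      ≤ eLpNorm (fun x => ‖a i x‖ + ‖v i x‖) 2 ν := by
        refine eLpNorm_mono fun x => ?_
        rw [Real.norm_of_nonneg (by positivity)]
        exact norm_jet_le _ _
    _ ≤ eLpNorm (fun x => ‖a i x‖) 2 ν + eLpNorm (fun x => ‖v i x‖) 2 ν :=
        eLpNorm_add_le (ham i).norm (hvm i).norm (by norm_num)
    _ = _ := by rw [eLpNorm_norm, eLpNorm_norm]

theorem eLpNorm_comp_snd_prod {X Y W : Type*} [MeasurableSpace X] [MeasurableSpace Y]
    [NormedAddCommGroup W] {μ : Measure X} {ν : Measure Y} [SFinite ν] [IsFiniteMeasure μ]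
    {f : Y → W} (hf : AEStronglyMeasurable f ν) :
    eLpNorm (fun p : X × Y => f p.2) 2 (μ.prod ν) =
      μ univ ^ (1 / 2 : ℝ) * eLpNorm f 2 ν := by
  have hf' : AEStronglyMeasurable f ((μ.prod ν).map Prod.snd) := by
    simpa using hf.smul_measure (μ univ)
  have := eLpNorm_map_measure (p := 2) hf' measurable_snd.aemeasurable
  rw [Measure.map_snd_prod, eLpNorm_smul_measure_of_ne_top (by norm_num)] at this
  simpa [Function.comp_def] using this.symm

theorem IsTest.memLp {D : Set (E n)} {ψ : E n → ℝ} (h : IsTest D ψ) (ν : Measure (E n))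
    [IsFiniteMeasureOnCompacts ν] : MemLp ψ 2 ν :=
  h.1.continuous.memLp_of_hasCompactSupport h.2.1

theorem IsTest.continuous_gradient {D : Set (E n)} {ψ : E n → ℝ} (h : IsTest D ψ) :
    Continuous (gradient ψ) :=
  (InnerProductSpace.toDual ℝ (E n)).symm.continuous.comp (h.1.continuous_fderiv (by simp))

theorem IsTest.memLp_gradient {D : Set (E n)} {ψ : E n → ℝ} (h : IsTest D ψ) (ν : Measure (E n))
    [IsFiniteMeasureOnCompacts ν] : MemLp (gradient ψ) 2 ν := by
  refine h.continuous_gradient.memLp_of_hasCompactSupport ?_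
  exact (h.2.1.fderiv ℝ).comp_left (g := (InnerProductSpace.toDual ℝ (E n)).symm) (by simp)

theorem prod_restrict_Ioc_le {T τ : ℝ} (hτ : τ ≤ T) (D : Set (E n)) :
    (volume.restrict (Ioc 0 τ)).prod (volume.restrict D) ≤ volume.restrict (Ioo 0 T ×ˢ D) := by
  rw [Measure.volume_eq_prod, ← restrict_Ioo_eq_restrict_Ioc, Measure.prod_restrict]
  exact Measure.restrict_mono (prod_mono (Ioo_subset_Ioo_right hτ) subset_rfl) le_rfl

theorem memLp_prod_restrict_Ioc {W : Type*} [NormedAddCommGroup W] {T τ : ℝ} (hτ : τ ≤ T)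
    {D : Set (E n)} {F : ℝ × E n → W} (hF : MemLp F 2 (volume.restrict (Ioo 0 T ×ˢ D))) :
    MemLp F 2 ((volume.restrict (Ioc 0 τ)).prod (volume.restrict D)) :=
  hF.mono_measure (prod_restrict_Ioc_le hτ D)

theorem intervalIntegral_setIntegral_eq_prod {τ : ℝ} (hτ : 0 ≤ τ) {D : Set (E n)}
    {F : ℝ × E n → ℝ}
    (hF : Integrable F ((volume.restrict (Ioc 0 τ)).prod (volume.restrict D))) :
    ∫ s in (0:ℝ)..τ, ∫ x in D, F (s, x) =
      ∫ p, F p ∂((volume.restrict (Ioc 0 τ)).prod (volume.restrict D)) := by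
  rw [intervalIntegral.integral_of_le hτ, integral_prod _ hF]

/-- A weak formulation that holds for all test functions holds for all elements of `H¹`. -/
theorem weak_formulation_of_memH1 {T τ : ℝ} (hτ : τ ∈ Icc 0 T) {D : Set (E n)}
    {G : ℝ → E n → E n} {k : ℝ → E n → ℝ}
    (hG : MemLp (fun p : ℝ × E n => G p.1 p.2) 2 (volume.restrict (Ioo 0 T ×ˢ D)))
    (hk : MemLp (fun p : ℝ × E n => k p.1 p.2) 2 (volume.restrict (Ioo 0 T ×ˢ D)))
    {v : E n → ℝ} (hv : MemLp v 2 (volume.restrict D))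
    (heq : ∀ ψ, IsTest D ψ → ∫ x in D, v x * ψ x =
      ∫ s in (0 : ℝ)..τ, ∫ x in D, (inner ℝ (G s x) (gradient ψ x) + k s x * ψ x))
    {φ : E n → ℝ} {γ : E n → E n} (hφ : MemH1 D φ γ) :
    ∫ x in D, v x * φ x =
      ∫ s in (0 : ℝ)..τ, ∫ x in D, (inner ℝ (G s x) (γ x) + k s x * φ x) := by
  obtain ⟨hφm, hγm, ψ, hψ, hψt, hgt⟩ := hφ
  set ν := (volume.restrict (Ioc 0 τ)).prod (volume.restrict D) with hν
  have hA := memLp_jet (memLp_prod_restrict_Ioc hτ.2 hk) (memLp_prod_restrict_Ioc hτ.2 hG)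
  -- In terms of jets the right side is a single L² pairing on (0,τ] × D, so value and gradient pass
  -- to the limit together.
  have conv : ∀ {a : E n → ℝ} {c : E n → E n}, MemLp a 2 (volume.restrict D) →
      MemLp c 2 (volume.restrict D) →
      ∫ s in (0 : ℝ)..τ, ∫ x in D, (inner ℝ (G s x) (c x) + k s x * a x) =
        ∫ p, inner ℝ (jet (k p.1 p.2) (G p.1 p.2)) (jet (a p.2) (c p.2)) ∂ν := by
    intro a c ha hc
    have hJ := (memLp_jet ha hc).comp_snd (volume.restrict (Ioc 0 τ))
    rw [hν, ← intervalIntegral_setIntegral_eq_prod hτ.1 (integrable_inner_of_memLp hA hJ)]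
    simp only [inner_jet]
  have hψm := fun i => (hψ i).memLp (volume.restrict D)
  have hgm := fun i => (hψ i).memLp_gradient (volume.restrict D)
  have l1 : Tendsto (fun i => ∫ x in D, inner ℝ (v x) (ψ i x)) atTop
      (𝓝 (∫ x in D, inner ℝ (v x) (φ x))) := by
    refine tendsto_integral_inner (fun _ => hv) hψm hv hφm (by simp) ?_
    refine hψt.congr fun i => ?_
    rw [eLpNorm_sub_comm]; rfl
  have l2 : Tendsto (fun i => ∫ p, inner ℝ (jet (k p.1 p.2) (G p.1 p.2))
      (jet (ψ i p.2) (gradient (ψ i) p.2)) ∂ν) atTop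
      (𝓝 (∫ p, inner ℝ (jet (k p.1 p.2) (G p.1 p.2)) (jet (φ p.2) (γ p.2)) ∂ν)) := by
    refine tendsto_integral_inner (fun _ => hA)
      (fun i => (memLp_jet (hψm i) (hgm i)).comp_snd _) hA ((memLp_jet hφm hγm).comp_snd _)
      (by simp) ?_
    have hJ := tendsto_eLpNorm_jet (fun i => (hφm.sub (hψm i)).1) (fun i => (hγm.sub (hgm i)).1)
      hψt hgt
    have hJ' := ENNReal.Tendsto.const_mul (a := volume.restrict (Ioc 0 τ) univ ^ (1 / 2 : ℝ)) hJ
      (Or.inr (by simp))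
    rw [mul_zero] at hJ'
    refine hJ'.congr fun i => ?_
    rw [← eLpNorm_comp_snd_prod (memLp_jet (hφm.sub (hψm i)) (hγm.sub (hgm i))).1,
      eLpNorm_sub_comm]
    rfl
  have e : ∀ i, ∫ x in D, inner ℝ (v x) (ψ i x) =
      ∫ p, inner ℝ (jet (k p.1 p.2) (G p.1 p.2)) (jet (ψ i p.2) (gradient (ψ i) p.2)) ∂ν := by
    intro i
    rw [← conv (hψm i) (hgm i), ← heq _ (hψ i)]
    simp [mul_comm]
  rw [conv hφm hγm]
  simp only [e] at l1
  rw [← tendsto_nhds_unique l1 l2]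
  simp [mul_comm]

theorem continuousOn_integral_sq {T : ℝ} {D : Set (E n)} {u : ℝ → E n → ℝ} (hu : MemC0 T D u) :
    ContinuousOn (fun s => ∫ x in D, u s x ^ 2) (Icc 0 T) := by
  rw [continuousOn_iff_continuous_domRestrict, continuous_iff_continuousAt]
  intro t
  have h := (hu.2 t t.2)
  rw [← map_nhds_subtype_val, tendsto_map'_iff] at h
  have := tendsto_integral_inner (l := 𝓝 t) (a := fun s : Icc 0 T => u s)
    (b := fun s : Icc 0 T => u s) (fun s => hu.1 s s.2) (fun s => hu.1 s s.2)
    (hu.1 t t.2) (hu.1 t t.2) h h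
  simpa [ContinuousAt, sq, Function.comp_def, domRestrict_def] using this

/-- Energy inequality for weak solutions that vanish initially. -/
theorem integral_sq_le_of_weak_formulation {T : ℝ} {D : Set (E n)} (hD : MeasurableSet D)
    {u : ℝ → E n → ℝ} {g G : ℝ → E n → E n} {k : ℝ → E n → ℝ}
    (hX : MemX1 T D u g) (hC : MemC0 T D u) (h0 : ∀ᵐ x ∂(volume.restrict D), u 0 x = 0)
    (hG : MemLp (fun p : ℝ × E n => G p.1 p.2) 2 (volume.restrict (Ioo 0 T ×ˢ D)))
    (hk : MemLp (fun p : ℝ × E n => k p.1 p.2) 2 (volume.restrict (Ioo 0 T ×ˢ D)))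
    (heq : ∀ t ∈ Icc 0 T, ∀ ψ, IsTest D ψ → ∫ x in D, u t x * ψ x =
      ∫ s in (0 : ℝ)..t, ∫ x in D, (inner ℝ (G s x) (gradient ψ x) + k s x * ψ x))
    {t : ℝ} (ht : t ∈ Icc 0 T) :
    ∫ x in D, u t x ^ 2 ≤
      2 * ∫ s in (0 : ℝ)..t, ∫ x in D, (inner ℝ (G s x) (g s x) + k s x * u s x) := by
  have hz : ∫ x in D, u 0 x ^ 2 = 0 := by
    refine integral_eq_zero_of_ae ?_
    filter_upwards [h0] with x hx
    simp [hx]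
  rcases ht.1.eq_or_lt with rfl | ht0
  · simp [hz]
  have hT : 0 < T := ht0.trans_le ht.2
  have hQ : ∀ τ : ℝ, MeasurableSet (Ioo 0 τ ×ˢ D) := fun τ => measurableSet_Ioo.prod hD
  -- Extension by zero makes all time shifts meaningful; `w` is cut off already at `t`.
  set A : ℝ × E n → Jet n := (Ioo 0 T ×ˢ D).indicator fun p => jet (k p.1 p.2) (G p.1 p.2)
    with hAdef
  set w : ℝ × E n → Jet n := (Ioo 0 t ×ˢ D).indicator fun p => jet (u p.1 p.2) (g p.1 p.2)
    with hwdef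
  have hA : MemLp A 2 volume := (memLp_indicator_iff_restrict (hQ T)).2 (memLp_jet hk hG)
  have hw : MemLp w 2 volume := (memLp_indicator_iff_restrict (hQ t)).2
    ((memLp_jet hX.1 hX.2.1).mono_measure
      (Measure.restrict_mono (prod_mono (Ioo_subset_Ioo_right ht.2) subset_rfl) le_rfl))
  have hpair : ∀ r s, r ∈ Ioo 0 T → s ∈ Ioo 0 t → ∫ x, inner ℝ (A (r, x)) (w (s, x)) =
      ∫ x in D, (inner ℝ (G r x) (g s x) + k r x * u s x) := by
    intro r s hr hs
    rw [← integral_indicator hD]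
    congr 1
    funext x
    by_cases hx : x ∈ D
    · have e1 : A (r, x) = jet (k r x) (G r x) := indicator_of_mem (mk_mem_prod hr hx) _
      have e2 : w (s, x) = jet (u s x) (g s x) := indicator_of_mem (mk_mem_prod hs hx) _
      rw [indicator_of_mem hx, e1, e2, inner_jet]
    · simp [hAdef, hx]
  -- Freezing time at 0 extends the energy by zero to negative times, since u(0) = 0.
  set y : ℝ → ℝ := fun s => ∫ x in D, u (max s 0) x ^ 2 with hy
  have hyc : ContinuousOn y (Icc (-t) t) := by
    refine (continuousOn_integral_sq hC).comp (f := fun s => max s 0) (by fun_prop) ?_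
    intro s hs
    exact ⟨le_max_right _ _, max_le (hs.2.trans ht.2) hT.le⟩
  have hyt : y t = ∫ x in D, u t x ^ 2 := by simp [hy, ht.1]
  have hmain : y t ≤ 2 * ∫ p, inner ℝ (A p) (w p) := by
    refine le_two_mul_integral_inner_of_increment_le hA hw ht0 ?_ ?_ ?_ ?_ ?_
    · intro s x hs
      refine indicator_of_notMem (fun h => hs ⟨h.1.1, h.1.2.le⟩) _
    · intro s hs
      simp [hy, hs, hz]
    · refine ContinuousOn.intervalIntegrable ?_
      rwa [uIcc_of_le (by linarith)]
    · refine (hyc t ⟨by linarith, le_rfl⟩).mono_of_mem_nhdsWithin ?_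
      exact Icc_mem_nhdsLE (by linarith)
    · intro h hh
      have hae := (ae_restrict_iff' measurableSet_Ioo).1 hX.2.2
      filter_upwards [hae, (measure_eq_zero_iff_ae_notMem).1 (Real.volume_singleton (a := t))]
        with s hs hst hst'
      have hs1 : s ∈ Ioo 0 t := ⟨hst'.1, lt_of_le_of_ne hst'.2 hst⟩
      have hH := hs ⟨hs1.1, hs1.2.trans_le ht.2⟩
      set q : ℝ → ℝ := fun r => ∫ x, inner ℝ (A (r, x)) (w (s, x)) with hq
      have hwsm : MemLp (fun x => w (s, x)) 2 volume := by
        have : (fun x => w (s, x)) = D.indicator fun x => jet (u s x) (g s x) := by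
          funext x
          by_cases hx : x ∈ D <;> simp [hwdef, hx, hs1.1, hs1.2]
        rw [this]
        exact (memLp_indicator_iff_restrict hD).2 (memLp_jet hH.1 hH.2.1)
      have hqI : ∀ a b, IntervalIntegrable q volume a b := by
        intro a b
        rw [intervalIntegrable_iff]
        have m1 : MemLp A 2 ((volume.restrict (uIoc a b)).prod volume) := by
          rw [← Measure.restrict_univ (μ := (volume : Measure (E n))), Measure.prod_restrict]
          exact hA.restrict _
        have : IsFiniteMeasure (volume.restrict (uIoc a b)) :=
          inferInstanceAs (IsFiniteMeasure (volume.restrict (Ioc (min a b) (max a b))))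
        exact (integrable_inner_of_memLp m1 (hwsm.comp_snd _)).integral_prod_left
      -- Here u(s), which lies in H¹ for almost every `s`, serves as a fixed test function, while
      -- the time τ of the equation varies.
      have hΦ : ∀ τ ∈ Icc 0 T, ∫ x in D, u τ x * u s x = ∫ r in (0:ℝ)..τ, q r := by
        intro τ hτ
        rw [weak_formulation_of_memH1 hτ hG hk (hC.1 τ hτ) (heq τ hτ) hH]
        refine intervalIntegral.integral_congr_ae ?_
        filter_upwards [(measure_eq_zero_iff_ae_notMem).1 (Real.volume_singleton (a := T))]
          with r hr hr'
        rw [uIoc_of_le hτ.1] at hr'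
        exact (hpair r s ⟨hr'.1, lt_of_le_of_ne (hr'.2.trans hτ.2) hr⟩ hs1).symm
      set σ := max (s - h) 0 with hσ
      have hσT : σ ∈ Icc 0 T := ⟨le_max_right _ _, max_le (by linarith [hh.1, hs1.2, ht.2]) hT.le⟩
      have hsT : s ∈ Icc 0 T := ⟨hs1.1.le, hs1.2.le.trans ht.2⟩
      -- Clamping s-h at 0 is harmless, because `A` vanishes at negative times.
      have hq0 : ∫ r in (0:ℝ)..σ, q r = ∫ r in (0:ℝ)..(s - h), q r := by
        rcases le_total 0 (s - h) with h' | h'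
        · rw [hσ, max_eq_left h']
        · rw [hσ, max_eq_right h', intervalIntegral.integral_same,
            intervalIntegral.integral_of_ge h', setIntegral_eq_zero_of_forall_eq_zero, neg_zero]
          intro r hr
          have : ∀ x, A (r, x) = 0 := fun x =>
            indicator_of_notMem (fun hm => absurd hm.1.1 (not_lt.2 hr.2)) _
          simp [hq, this]
      have hθ : ∫ θ in Ioc 0 h, ∫ x, inner ℝ (A (s - θ, x)) (w (s, x)) =
          ∫ r in (s - h)..s, q r := by
        rw [← intervalIntegral.integral_of_le hh.1.le]
        have := intervalIntegral.integral_comp_sub_left q s (a := 0) (b := h)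
        rw [sub_zero] at this
        exact this
      have hsplit := intervalIntegral.integral_interval_sub_left (hqI 0 s) (hqI 0 (s - h))
      rw [hθ, ← hsplit, ← hq0, ← hΦ s hsT, ← hΦ σ hσT]
      have i1 : Integrable (fun x => u s x * u s x) (volume.restrict D) := by
        simpa only [sq] using (hC.1 s hsT).integrable_sq
      have i2 : Integrable (fun x => u σ x * u s x) (volume.restrict D) := by
        simpa [mul_comm] using integrable_inner_of_memLp (hC.1 σ hσT) (hC.1 s hsT)
      have i3 : Integrable (fun x => u σ x ^ 2) (volume.restrict D) := (hC.1 σ hσT).integrable_sq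
      have i4 : Integrable (fun x => u s x ^ 2) (volume.restrict D) := (hC.1 s hsT).integrable_sq
      have hys : y s = ∫ x in D, u s x ^ 2 := by simp [hy, hs1.1.le]
      have hyσ : y (s - h) = ∫ x in D, u σ x ^ 2 := rfl
      rw [hys, hyσ, ← integral_sub i4 i3, ← integral_sub i1 i2, ← integral_const_mul]
      refine integral_mono (i4.sub i3) ((i1.sub i2).const_mul 2) fun x => ?_
      simp only
      -- Pointwise, p² - q² ≤ 2(p - q)p, the difference being (p - q)².
      nlinarith [sq_nonneg (u s x - u σ x)]
  rw [← hyt]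
  refine hmain.trans_eq ?_
  congr 1
  rw [Measure.volume_eq_prod, integral_prod _ (integrable_inner_of_memLp hA hw),
    intervalIntegral.integral_of_le ht.1, integral_Ioc_eq_integral_Ioo,
    ← setIntegral_eq_integral_of_forall_compl_eq_zero (s := Ioo 0 t)]
  · exact setIntegral_congr_fun measurableSet_Ioo fun s hs =>
      hpair s s ⟨hs.1, hs.2.trans_le ht.2⟩ hs
  · intro s hs
    have : ∀ x, w (s, x) = 0 := fun x => indicator_of_notMem (fun hm => hs hm.1) _
    simp [this]

/-! ### Matrix algebra and the pointwise energy bound. -/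

theorem mulVecE_apply (A : Matrix (Fin n) (Fin n) ℝ) (v : E n) (i : Fin n) :
    mulVecE A v i = ∑ j, A i j * v j := rfl

theorem mulVecE_add (A : Matrix (Fin n) (Fin n) ℝ) (v w : E n) :
    mulVecE A (v + w) = mulVecE A v + mulVecE A w := by
  simp [mulVecE, Matrix.mulVec_add]

theorem mulVecE_smul (A : Matrix (Fin n) (Fin n) ℝ) (c : ℝ) (v : E n) :
    mulVecE A (c • v) = c • mulVecE A v := by
  simp [mulVecE, Matrix.mulVec_smul]

theorem mulVecE_mulVecE (A B : Matrix (Fin n) (Fin n) ℝ) (v : E n) :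
    mulVecE A (mulVecE B v) = mulVecE (A * B) v := by
  simp [mulVecE, Matrix.mulVec_mulVec]

theorem mulVecE_one (v : E n) : mulVecE 1 v = v := by
  simp [mulVecE]

theorem inner_mulVecE_comm {A : Matrix (Fin n) (Fin n) ℝ} (hA : A.IsSymm) (v w : E n) :
    inner ℝ v (mulVecE A w) = inner ℝ w (mulVecE A v) := by
  simp only [PiLp.inner_apply, mulVecE_apply, RCLike.inner_apply, conj_trivial, Finset.sum_mul]
  rw [Finset.sum_comm]
  refine Finset.sum_congr rfl fun i _ => Finset.sum_congr rfl fun j _ => ?_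
  rw [hA.apply i j]
  ring

theorem norm_mulVecE_le (A : Matrix (Fin n) (Fin n) ℝ) (v : E n) :
    ‖mulVecE A v‖ ≤ frob A * ‖v‖ := by
  have h0 : 0 ≤ frob A := Real.sqrt_nonneg _
  refine (sq_le_sq₀ (norm_nonneg _) (mul_nonneg h0 (norm_nonneg _))).1 ?_
  have hf : frob A ^ 2 = ∑ i, ∑ j, A i j ^ 2 := Real.sq_sqrt (by positivity)
  rw [mul_pow, hf, EuclideanSpace.real_norm_sq_eq,
    EuclideanSpace.real_norm_sq_eq, Finset.sum_mul]
  refine Finset.sum_le_sum fun i _ => ?_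
  rw [mulVecE_apply]
  exact Finset.sum_mul_sq_le_sq_mul_sq _ _ _

section Coercive

variable {A : Matrix (Fin n) (Fin n) ℝ} {δ : ℝ}

theorem mul_nonsing_inv_of_coercive (hδ : 0 < δ)
    (hA : ∀ ξ : E n, δ * ‖ξ‖ ^ 2 ≤ inner ℝ ξ (mulVecE A ξ)) : A * A⁻¹ = 1 := by
  refine Matrix.mul_nonsing_inv _ ?_
  rw [← Matrix.isUnit_iff_isUnit_det, ← Matrix.mulVec_injective_iff_isUnit]
  refine (injective_iff_map_eq_zero A.mulVecLin).2 fun v hv => ?_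
  have h := hA (WithLp.toLp 2 v)
  have h' : mulVecE A (WithLp.toLp 2 v) = 0 := by
    ext i; exact congrFun hv i
  rw [h', inner_zero_right] at h
  have h2 : ‖(WithLp.toLp 2 v : E n)‖ ^ 2 = 0 :=
    le_antisymm (by by_contra! hc; nlinarith) (by positivity)
  have h3 : (WithLp.toLp 2 v : E n) = 0 := by simpa using h2
  simpa using h3

theorem mulVecE_inv_cancel (hδ : 0 < δ)
    (hA : ∀ ξ : E n, δ * ‖ξ‖ ^ 2 ≤ inner ℝ ξ (mulVecE A ξ)) (v : E n) :
    mulVecE A (mulVecE A⁻¹ v) = v := by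
  rw [mulVecE_mulVecE, mul_nonsing_inv_of_coercive hδ hA, mulVecE_one]

theorem norm_mulVecE_inv_le (hδ : 0 < δ)
    (hA : ∀ ξ : E n, δ * ‖ξ‖ ^ 2 ≤ inner ℝ ξ (mulVecE A ξ)) (v : E n) :
    ‖mulVecE A⁻¹ v‖ ≤ δ⁻¹ * ‖v‖ := by
  have h := hA (mulVecE A⁻¹ v)
  rw [mulVecE_inv_cancel hδ hA] at h
  have h2 := real_inner_le_norm (mulVecE A⁻¹ v) v
  rw [inv_mul_eq_div, le_div_iff₀ hδ]
  by_contra! hc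
  have h3 : 0 < ‖mulVecE A⁻¹ v‖ := by
    rcases (norm_nonneg (mulVecE A⁻¹ v)).eq_or_lt with h0 | h0
    · rw [← h0] at hc; nlinarith [norm_nonneg v]
    · exact h0
  nlinarith [mul_lt_mul_of_pos_left hc h3]

/-- Young's inequality in the metric of a coercive matrix. -/
theorem neg_two_mul_inner_le_of_coercive (hδ : 0 < δ) (hs : A.IsSymm)
    (hA : ∀ ξ : E n, δ * ‖ξ‖ ^ 2 ≤ inner ℝ ξ (mulVecE A ξ)) {a : ℝ} (ha : 0 < a) (F g : E n) :
    -(2 * inner ℝ F g) ≤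
      1 / (2 * a) * inner ℝ F (mulVecE A⁻¹ F) + 2 * a * inner ℝ (mulVecE A g) g := by
  -- Completing the square: the quadratic form of `A` is nonnegative at A⁻¹F + 2ag, and its
  -- expansion divided by 2a is the claim.
  have h := hA (mulVecE A⁻¹ F + (2 * a) • g)
  have h0 : 0 ≤ δ * ‖mulVecE A⁻¹ F + (2 * a) • g‖ ^ 2 := by positivity
  have e := inner_mulVecE_comm hs (mulVecE A⁻¹ F) g
  rw [mulVecE_add, mulVecE_smul, mulVecE_inv_cancel hδ hA, inner_add_left, inner_add_right,
    inner_add_right, inner_smul_left, inner_smul_right, inner_smul_right, inner_smul_left, e,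
    mulVecE_inv_cancel hδ hA, real_inner_comm F, real_inner_comm F g,
    real_inner_comm (mulVecE A g)] at h
  simp only [conj_trivial] at h
  have h2 := h0.trans h
  have h3 : 1 / (2 * a) * inner ℝ F (mulVecE A⁻¹ F) + 2 * a * inner ℝ (mulVecE A g) g
      + 2 * inner ℝ F g = 1 / (2 * a) * (inner ℝ F (mulVecE A⁻¹ F) + 2 * a * inner ℝ F g +
        (2 * a * inner ℝ F g + 2 * a * (2 * a * inner ℝ (mulVecE A g) g))) := by
    field_simp
    ring
  have h4 : 0 ≤ 1 / (2 * a) * (inner ℝ F (mulVecE A⁻¹ F) + 2 * a * inner ℝ F g +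
        (2 * a * inner ℝ F g + 2 * a * (2 * a * inner ℝ (mulVecE A g) g))) :=
    mul_nonneg (by positivity) (by linarith)
  linarith

/-- The threshold in `hK` adds up the costs in v²: `M` from the extra term, 1 from 2F₀v ≤ F₀² + v²,
2B from `l`, and B²/(2(1-a)δ) from absorbing the drift into the remaining dissipation 2(1-a)δ‖g‖².
The coefficient of `F` is untouched by the lower-order terms. -/
theorem energy_integrand_le (hδ : 0 < δ) (hs : A.IsSymm)
    (hA : ∀ ξ : E n, δ * ‖ξ‖ ^ 2 ≤ inner ℝ ξ (mulVecE A ξ)) {a : ℝ} (ha : 0 < a) (ha1 : a < 1)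
    {B K M : ℝ} (hK : M + 1 + 2 * B + B ^ 2 / (2 * (1 - a) * δ) ≤ 2 * K)
    {f g F : E n} {l v F₀ : ℝ} (hB : ‖f‖ + |l| ≤ B) :
    2 * (inner ℝ (-mulVecE A g - F) g + (inner ℝ f g + l * v + F₀) * v) - 2 * K * v ^ 2
      + M * v ^ 2 ≤ 1 / (2 * a) * inner ℝ F (mulVecE A⁻¹ F) + F₀ ^ 2 := by
  have h1 := neg_two_mul_inner_le_of_coercive hδ hs hA ha F g
  have h2 := hA g
  rw [real_inner_comm] at h2
  obtain ⟨e, he⟩ : ∃ e, e = (1 - a) * δ := ⟨_, rfl⟩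
  have hε : 0 < e := he ▸ mul_pos (by linarith) hδ
  rw [show 2 * (1 - a) * δ = 2 * e by rw [he]; ring] at hK
  have hf : inner ℝ f g * v ≤ B * ‖g‖ * |v| := by
    calc inner ℝ f g * v ≤ |inner ℝ f g * v| := le_abs_self _
      _ = |inner ℝ f g| * |v| := abs_mul _ _
      _ ≤ (‖f‖ * ‖g‖) * |v| := by gcongr; exact abs_real_inner_le_norm f g
      _ ≤ _ := by gcongr; linarith [abs_nonneg l]
  have hl : l * v ^ 2 ≤ B * v ^ 2 := by
    gcongr; linarith [norm_nonneg f, le_abs_self l]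
  have hy : 2 * (B * ‖g‖ * |v|) ≤
      2 * e * ‖g‖ ^ 2 + B ^ 2 / (2 * e) * v ^ 2 := by
    have : 2 * e * ‖g‖ ^ 2 + B ^ 2 / (2 * e) * v ^ 2
        - 2 * (B * ‖g‖ * |v|) =
        2 * e * (‖g‖ - B * |v| / (2 * e)) ^ 2 := by
      rw [← sq_abs v]
      field_simp
      ring
    nlinarith [mul_nonneg (by positivity : 0 ≤ 2 * e)
      (sq_nonneg (‖g‖ - B * |v| / (2 * e)))]
  have h3 : e * ‖g‖ ^ 2 ≤ (1 - a) * inner ℝ (mulVecE A g) g := by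
    rw [he, mul_assoc]
    exact mul_le_mul_of_nonneg_left h2 (by linarith)
  have hKv := mul_le_mul_of_nonneg_right hK (sq_nonneg v)
  rw [inner_sub_left, inner_neg_left]
  nlinarith [sq_nonneg (F₀ - v)]

end Coercive

/-! ### Measurability of matrix-valued expressions. -/

section Measurability

variable {X : Type*} [MeasurableSpace X] {ν : Measure X}
  {A : X → Matrix (Fin n) (Fin n) ℝ} {v : X → E n}

theorem aestronglyMeasurable_mulVecE (hA : ∀ i j, AEMeasurable (fun x => A x i j) ν)
    (hv : AEStronglyMeasurable v ν) :
    AEStronglyMeasurable (fun x => mulVecE (A x) (v x)) ν := by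
  have hv' : ∀ j, AEMeasurable (fun x => v x j) ν := fun j =>
    ((EuclideanSpace.proj (𝕜 := ℝ) j).continuous.comp_aestronglyMeasurable hv).aemeasurable
  refine AEMeasurable.aestronglyMeasurable ?_
  refine (WithLp.measurable_toLp 2 (Fin n → ℝ)).comp_aemeasurable (aemeasurable_pi_lambda _ ?_)
  intro i
  change AEMeasurable (fun x => ∑ j, A x i j * v x j) ν
  exact Finset.aemeasurable_fun_sum _ fun j _ => (hA i j).mul (hv' j)

/-- The inverse is det⁻¹ times the adjugate, and both determinant and adjugate are continuous in the
entries. -/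
theorem aemeasurable_matrix_inv_apply (hA : ∀ i j, AEMeasurable (fun x => A x i j) ν)
    (i j : Fin n) : AEMeasurable (fun x => (A x)⁻¹ i j) ν := by
  have hA' : AEMeasurable (fun x => (fun i j => A x i j : Fin n → Fin n → ℝ)) ν :=
    aemeasurable_pi_lambda _ fun i => aemeasurable_pi_lambda _ fun j => hA i j
  have hof : Continuous (fun a : Fin n → Fin n → ℝ => Matrix.of a) := continuous_id
  have hdet : Measurable (fun a : Fin n → Fin n → ℝ => (Matrix.of a).det) :=
    hof.matrix_det.measurable
  have hadj : Measurable (fun a : Fin n → Fin n → ℝ => (Matrix.of a).adjugate i j) :=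
    (hof.matrix_adjugate.matrix_elem i j).measurable
  have h := (hdet.comp_aemeasurable hA').inv.mul (hadj.comp_aemeasurable hA')
  refine h.congr (Eventually.of_forall fun x => ?_)
  have e : (A x)⁻¹ i j = (A x).det⁻¹ * (A x).adjugate i j := by
    rw [Matrix.inv_def, Matrix.smul_apply, Ring.inverse_eq_inv', smul_eq_mul]
  exact e.symm

theorem memLp_mulVecE (hA : ∀ i j, AEMeasurable (fun x => A x i j) ν) {C : ℝ}
    (hC : ∀ᵐ x ∂ν, ‖mulVecE (A x) (v x)‖ ≤ C * ‖v x‖) (hv : MemLp v 2 ν) :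
    MemLp (fun x => mulVecE (A x) (v x)) 2 ν :=
  hv.of_le_mul (aestronglyMeasurable_mulVecE hA hv.1) hC

end Measurability

theorem ae_le_toReal_essSup {X : Type*} [MeasurableSpace X] {ν : Measure X} {f : X → ℝ}
    (h : essSup (fun x => ENNReal.ofReal (f x)) ν < ⊤) :
    ∀ᵐ x ∂ν, f x ≤ (essSup (fun x => ENNReal.ofReal (f x)) ν).toReal := by
  filter_upwards [ENNReal.ae_le_essSup (μ := ν) fun x => ENNReal.ofReal (f x)] with x hx
  exact (ENNReal.ofReal_le_iff_le_toReal h.ne).1 hx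

theorem frob_nonneg (A : Matrix (Fin n) (Fin n) ℝ) : 0 ≤ frob A := Real.sqrt_nonneg _

/-! ### The energy estimate for all data of a class. -/

namespace Params.Admissible

variable {μ : Params n}

theorem measurableSet_Q (h : μ.Admissible) : MeasurableSet μ.Q :=
  measurableSet_Ioo.prod h.domain.2.1.measurableSet

/-- The energy estimate with a constant above one half in front of the divergence part of the free
term. -/
theorem energyEstimate (h : μ.Admissible) {B a K M : ℝ}
    (hB0 : 0 ≤ B) (hB : ∀ᵐ p ∂(volume.restrict μ.Q), ‖μ.f p.1 p.2‖ + |μ.lam p.1 p.2| ≤ B)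
    (ha : 0 < a) (ha1 : a < 1) (hM : 0 ≤ M)
    (hK : M + 1 + 2 * B + B ^ 2 / (2 * (1 - a) * μ.δ) ≤ 2 * K) :
    EnergyEstimate μ K M (1 / (2 * a)) 1 := by
  intro F F₀ hF hF₀ u g hu t ht
  have hδ := h.δ_pos
  have hK0 : 0 ≤ K := by
    have : 0 ≤ B ^ 2 / (2 * (1 - a) * μ.δ) := by
      have : 0 < 1 - a := by linarith
      positivity
    linarith
  have hDm : MeasurableSet μ.D := h.domain.2.1.measurableSet
  have hQm := h.measurableSet_Q
  have hQae : ∀ᵐ p ∂(volume.restrict μ.Q), p ∈ μ.Q := ae_restrict_mem hQm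
  obtain ⟨C, hC⟩ : ∃ C : ℝ, ∀ᵐ p ∂(volume.restrict μ.Q), frob (μ.b p.1 p.2) ≤ C := by
    refine ⟨_, (ae_le_toReal_essSup h.bounded).mono fun p hp => le_trans ?_ hp⟩
    have := frob_nonneg (μ.b p.1 p.2)⁻¹
    have := norm_nonneg (μ.f p.1 p.2)
    have := abs_nonneg (μ.lam p.1 p.2)
    linarith
  have hbg : MemLp (fun p : ℝ × E n => mulVecE (μ.b p.1 p.2) (g p.1 p.2)) 2
      (volume.restrict μ.Q) := by
    refine memLp_mulVecE h.b_meas (C := C) ?_ hu.memX1.2.1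
    filter_upwards [hC] with p hp
    exact (norm_mulVecE_le _ _).trans (by gcongr)
  have hbF : MemLp (fun p : ℝ × E n => mulVecE (μ.b p.1 p.2)⁻¹ (F p.1 p.2)) 2
      (volume.restrict μ.Q) := by
    refine memLp_mulVecE (aemeasurable_matrix_inv_apply h.b_meas) (C := μ.δ⁻¹) ?_ hF
    filter_upwards [hQae] with p hp
    exact norm_mulVecE_inv_le hδ (h.coercive p hp) _
  have hG : MemLp (fun p : ℝ × E n => -mulVecE (μ.b p.1 p.2) (g p.1 p.2) - F p.1 p.2) 2
      (volume.restrict μ.Q) := hbg.neg.sub hF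
  have hk : MemLp (fun p : ℝ × E n => inner ℝ (μ.f p.1 p.2) (g p.1 p.2)
      + μ.lam p.1 p.2 * u p.1 p.2 + F₀ p.1 p.2) 2 (volume.restrict μ.Q) := by
    refine MemLp.add (MemLp.add ?_ ?_) hF₀
    · refine hu.memX1.2.1.of_le_mul (c := B)
        (h.f_meas.aestronglyMeasurable.inner hu.memX1.2.1.1) ?_
      filter_upwards [hB] with p hp
      refine (norm_inner_le_norm _ _).trans ?_
      gcongr
      linarith [abs_nonneg (μ.lam p.1 p.2)]
    · refine hu.memX1.1.of_le_mul (c := B)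
        (h.lam_meas.aestronglyMeasurable.mul hu.memX1.1.1) ?_
      filter_upwards [hB] with p hp
      rw [norm_mul, Real.norm_eq_abs (μ.lam _ _)]
      gcongr
      linarith [norm_nonneg (μ.f p.1 p.2)]
  -- The equation is regrouped into a flux -b∇u - F and a zero-order part, both in L².
  have hineq : ∀ s ∈ Icc 0 μ.T, ∫ x in μ.D, u s x ^ 2 ≤ 2 * ∫ r in (0 : ℝ)..s, ∫ x in μ.D,
      (inner ℝ (-mulVecE (μ.b r x) (g r x) - F r x) (g r x) +
        (inner ℝ (μ.f r x) (g r x) + μ.lam r x * u r x + F₀ r x) * u r x) := by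
    intro s hs
    refine integral_sq_le_of_weak_formulation hDm hu.memX1 hu.memC0 hu.init
      (G := fun r x => -mulVecE (μ.b r x) (g r x) - F r x)
      (k := fun r x => inner ℝ (μ.f r x) (g r x) + μ.lam r x * u r x + F₀ r x) hG hk ?_ hs
    intro τ hτ ψ hψ
    rw [hu.eqn τ hτ ψ hψ]
    congr 1
    funext r
    congr 1
    funext x
    rw [inner_sub_left, inner_neg_left]
    ring
  set Φ : ℝ × E n → ℝ := fun p =>
    inner ℝ (-mulVecE (μ.b p.1 p.2) (g p.1 p.2) - F p.1 p.2) (g p.1 p.2) +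
      (inner ℝ (μ.f p.1 p.2) (g p.1 p.2) + μ.lam p.1 p.2 * u p.1 p.2 + F₀ p.1 p.2) * u p.1 p.2
    with hΦ
  set ν := (volume.restrict (Ioc 0 t)).prod (volume.restrict μ.D) with hν
  have hνQ : ν ≤ volume.restrict μ.Q := prod_restrict_Ioc_le ht.2 μ.D
  have hΦI : Integrable Φ ν := by
    refine Integrable.mono_measure ?_ hνQ
    refine (integrable_inner_of_memLp hG hu.memX1.2.1).add ?_
    exact (integrable_inner_of_memLp hu.memX1.1 hk)
  have huI : Integrable (fun p : ℝ × E n => u p.1 p.2 ^ 2) ν :=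
    (hu.memX1.1.integrable_sq).mono_measure hνQ
  have hFI : Integrable (fun p : ℝ × E n =>
      inner ℝ (F p.1 p.2) (mulVecE (μ.b p.1 p.2)⁻¹ (F p.1 p.2))) ν :=
    (integrable_inner_of_memLp hF hbF).mono_measure hνQ
  have hF₀I : Integrable (fun p : ℝ × E n => F₀ p.1 p.2 ^ 2) ν :=
    hF₀.integrable_sq.mono_measure hνQ
  have ii : ∀ {f : ℝ × E n → ℝ}, Integrable f ν →
      IntervalIntegrable (fun s => ∫ x in μ.D, f (s, x)) volume 0 t := fun hf =>
    (intervalIntegrable_iff_integrableOn_Ioc_of_le ht.1.le).2 hf.integral_prod_left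
  have hexpc : ContinuousOn (fun s : ℝ => Real.exp (-2 * K * s)) (uIcc 0 t) := by fun_prop
  have key := exp_mul_le_integral_of_le_integral hK0 ht.1.le ((ii hΦI).const_mul 2) (ii huI)
    (fun s hs => by
      rw [intervalIntegral.integral_const_mul]
      exact hineq s ⟨hs.1, hs.2.trans ht.2⟩)
  have hpt : ∀ᵐ p ∂ν, 2 * Φ p - 2 * K * u p.1 p.2 ^ 2 + M * u p.1 p.2 ^ 2 ≤
      1 / (2 * a) * inner ℝ (F p.1 p.2) (mulVecE (μ.b p.1 p.2)⁻¹ (F p.1 p.2))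
        + F₀ p.1 p.2 ^ 2 := by
    have hac : ν ≪ volume.restrict μ.Q := Measure.absolutelyContinuous_of_le hνQ
    filter_upwards [hac.ae_le hQae, hac.ae_le hB] with p hp hpB
    exact energy_integrand_le hδ (h.symm p hp) (h.coercive p hp) ha ha1 hK hpB
  have hs : ∀ᵐ s ∂(volume.restrict (Ioc 0 t)),
      2 * (∫ x in μ.D, Φ (s, x)) - 2 * K * (∫ x in μ.D, u s x ^ 2) + M * (∫ x in μ.D, u s x ^ 2) ≤
      1 / (2 * a) * (∫ x in μ.D, inner ℝ (F s x) (mulVecE (μ.b s x)⁻¹ (F s x)))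
        + ∫ x in μ.D, F₀ s x ^ 2 := by
    filter_upwards [Measure.ae_ae_of_ae_prod hpt, hΦI.prod_right_ae, huI.prod_right_ae,
      hFI.prod_right_ae, hF₀I.prod_right_ae] with s h1 h2 h3 h4 h5
    have h6 : Integrable (fun x => 2 * Φ (s, x) - 2 * K * u s x ^ 2) (volume.restrict μ.D) :=
      (h2.const_mul 2).sub (h3.const_mul (2 * K))
    rw [← integral_const_mul, ← integral_const_mul, ← integral_const_mul, ← integral_const_mul,
      ← integral_sub (h2.const_mul 2) (h3.const_mul (2 * K)),
      ← integral_add h6 (h3.const_mul M),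
      ← integral_add (h4.const_mul _) h5]
    exact integral_mono_ae (h6.add (h3.const_mul M)) ((h4.const_mul _).add h5) h1
  have e1 := ((ii hΦI).const_mul 2).sub ((ii huI).const_mul (2 * K))
  have m1 := e1.continuousOn_mul hexpc
  have m2 := ((ii huI).continuousOn_mul hexpc)
  have m3 := ((ii hFI).continuousOn_mul hexpc)
  have m4 := ((ii hF₀I).continuousOn_mul hexpc)
  have hfin : (∫ s in (0:ℝ)..t, Real.exp (-2 * K * s) * (2 * (∫ x in μ.D, Φ (s, x))
      - 2 * K * ∫ x in μ.D, u s x ^ 2)) +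
        M * ∫ s in (0 : ℝ)..t, Real.exp (-2 * K * s) * ∫ x in μ.D, u s x ^ 2 ≤
      1 / (2 * a) * (∫ s in (0 : ℝ)..t, Real.exp (-2 * K * s) *
        ∫ x in μ.D, inner ℝ (F s x) (mulVecE (μ.b s x)⁻¹ (F s x))) +
        1 * ∫ s in (0 : ℝ)..t, Real.exp (-2 * K * s) * ∫ x in μ.D, F₀ s x ^ 2 := by
    rw [one_mul, ← intervalIntegral.integral_const_mul, ← intervalIntegral.integral_const_mul,
      ← intervalIntegral.integral_add m1 (m2.const_mul M),
      ← intervalIntegral.integral_add (m3.const_mul _) m4]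
    refine intervalIntegral.integral_mono_ae_restrict ht.1.le (m1.add (m2.const_mul M))
      ((m3.const_mul _).add m4) ?_
    rw [← restrict_Ioc_eq_restrict_Icc]
    filter_upwards [hs] with s hs
    have := mul_le_mul_of_nonneg_left hs (Real.exp_pos (-2 * K * s)).le
    linarith
  linarith

end Params.Admissible

/-- `K` is the threshold of `energy_integrand_le`; besides `M` and `a` it involves only δ and the
essential bound, so the same `K` serves every member of the class. -/
theorem C₁_le {P : ParamClass n} (hP : P.bound ≠ ⊤) (hδ : 0 < P.δ) {a M : ℝ} (ha : 0 < a)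
    (ha1 : a < 1) (hM : 0 ≤ M) :
    ∃ K : ℝ, 0 ≤ K ∧ C₁ K M P ≤ ENNReal.ofReal (1 / (2 * a)) := by
  set B := P.bound.toReal with hBdef
  have hB0 : 0 ≤ B := ENNReal.toReal_nonneg
  have h1a : 0 < 1 - a := by linarith
  refine ⟨(M + 1 + 2 * B + B ^ 2 / (2 * (1 - a) * P.δ)) / 2, by positivity, ?_⟩
  refine sInf_le ⟨1 / (2 * a), 1, by positivity, one_pos, rfl, fun μ hμ hμP => ?_⟩
  have hμδ : μ.δ = P.δ := congrArg ParamClass.δ hμP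
  refine hμ.energyEstimate hB0 ?_ ha ha1 hM (by rw [hμδ]; linarith)
  have hb : μ.P.bound = P.bound := congrArg ParamClass.bound hμP
  have hlt : μ.P.bound < ⊤ := by rw [hb]; exact hP.lt_top
  filter_upwards [ae_le_toReal_essSup hlt] with p hp
  have : (essSup (fun p : ℝ × E n => ENNReal.ofReal (frob (μ.b p.1 p.2) + ‖μ.f p.1 p.2‖
    + |μ.lam p.1 p.2|)) (volume.restrict μ.Q)).toReal = B := by rw [hBdef, ← hb]; rfl
  rw [this] at hp
  linarith [frob_nonneg (μ.b p.1 p.2)]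

/-! ### The interval (-π, π) as a one-dimensional domain. -/

section Coordinate

theorem norm_eq_abs_coord (x : E 1) : ‖x‖ = |x 0| := by
  simp [EuclideanSpace.norm_eq, Real.sqrt_sq_eq_abs]

theorem inner_eq_mul_coord (x y : E 1) : inner ℝ x y = x 0 * y 0 := by
  simp [PiLp.inner_apply, mul_comm]

/-- The unit vector of the line `E 1`. -/
def unitVec : E 1 := EuclideanSpace.single 0 1

@[simp] theorem unitVec_zero : unitVec 0 = 1 := by simp [unitVec]

theorem coord_smul_unitVec (x : E 1) : x 0 • unitVec = x := by
  ext i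
  fin_cases i
  simp

/-- The first coordinate as a continuous linear map. -/
def coord : E 1 →L[ℝ] ℝ := EuclideanSpace.proj 0

@[simp] theorem coord_apply (x : E 1) : coord x = x 0 := rfl

theorem measurePreserving_coord : MeasurePreserving (fun x : E 1 => x 0) volume volume :=
  (volume_preserving_funUnique (Fin 1) ℝ).comp (PiLp.volume_preserving_ofLp (Fin 1))

theorem measurableEmbedding_coord : MeasurableEmbedding (fun x : E 1 => x 0) :=
  (MeasurableEquiv.funUnique (Fin 1) ℝ).measurableEmbedding.comp
    (MeasurableEquiv.toLp 2 (Fin 1 → ℝ)).symm.measurableEmbedding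

/-- The interval `(-π, π)` as a subset of `E 1`. -/
def interval : Set (E 1) := {x | x 0 ∈ Ioo (-Real.pi) Real.pi}

theorem setIntegral_interval (h : ℝ → ℝ) :
    ∫ x in interval, h (x 0) = ∫ y in (-Real.pi)..Real.pi, h y := by
  rw [intervalIntegral.integral_of_le (by linarith [Real.pi_pos]), integral_Ioc_eq_integral_Ioo]
  exact measurePreserving_coord.setIntegral_preimage_emb measurableEmbedding_coord h _

theorem isOpen_interval : IsOpen interval := isOpen_Ioo.preimage coord.continuous

theorem isBounded_interval : Bornology.IsBounded interval := by
  refine (Metric.isBounded_closedBall (x := (0 : E 1)) (r := Real.pi)).subset fun x hx => ?_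
  rw [mem_closedBall_zero_iff, norm_eq_abs_coord]
  exact (abs_lt.2 hx).le

theorem isConnected_interval : IsConnected interval := by
  refine ((convex_Ioo (-Real.pi) Real.pi).linear_preimage (coord : E 1 →ₗ[ℝ] ℝ)).isConnected ?_
  exact ⟨0, by simp [Real.pi_pos]⟩

theorem sq_lt_sq_pi_iff (y : ℝ) : y ^ 2 < Real.pi ^ 2 ↔ y ∈ Ioo (-Real.pi) Real.pi := by
  rw [sq_lt_sq, abs_of_pos Real.pi_pos, abs_lt]; rfl

theorem hasC2Boundary_interval : HasC2Boundary interval := by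
  intro x hx
  -- One global defining function works: its differential vanishes only at 0, which is not a
  -- boundary point.
  refine ⟨univ, fun y => y 0 ^ 2 - Real.pi ^ 2, isOpen_univ, mem_univ _, ?_, ?_, ?_⟩
  · exact ((coord.contDiff.pow 2).sub contDiff_const).contDiffOn
  · have hd : HasFDerivAt (fun y : E 1 => y 0 ^ 2 - Real.pi ^ 2) ((2 * x 0) • coord) x := by
      simpa using (coord.hasFDerivAt (x := x)).pow 2 |>.sub_const (Real.pi ^ 2)
    rw [hd.fderiv]
    intro h0
    have h1 := DFunLike.congr_fun h0 unitVec
    have h2 : x 0 = 0 := by simpa using h1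
    rw [isOpen_interval.frontier_eq] at hx
    exact hx.2 (by simp [interval, h2, Real.pi_pos])
  · ext y
    simpa [interval, sub_neg] using (sq_lt_sq_pi_iff (y 0)).symm

end Coordinate

theorem admissible_heatParams {T δ : ℝ} (hT : 0 < T) (hδ : 0 < δ) (hδ1 : δ ≤ 1) :
    (heatParams T δ).Admissible where
  T_pos := hT
  domain := ⟨one_pos, isOpen_interval, isConnected_interval,
    Or.inr ⟨isBounded_interval, hasC2Boundary_interval⟩⟩
  δ_pos := hδ
  symm _ _ := Matrix.isSymm_one
  coercive p _ ξ := by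
    change δ * ‖ξ‖ ^ 2 ≤ inner ℝ ξ (mulVecE 1 ξ)
    rw [mulVecE_one, real_inner_self_eq_norm_sq]
    exact mul_le_of_le_one_left (by positivity) hδ1
  b_meas _ _ := aemeasurable_const
  f_meas := aemeasurable_const
  lam_meas := aemeasurable_const
  bounded := (essSup_le_of_ae_le (ENNReal.ofReal (frob (1 : Matrix (Fin 1) (Fin 1) ℝ) +
    frob (1 : Matrix (Fin 1) (Fin 1) ℝ)⁻¹ + ‖(0 : E 1)‖ + |(0 : ℝ)|))
    (Eventually.of_forall fun _ => le_rfl)).trans_lt ENNReal.ofReal_lt_top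

theorem bound_heatParams_ne_top (T δ : ℝ) : (heatParams T δ).P.bound ≠ ⊤ :=
  ((essSup_le_of_ae_le (ENNReal.ofReal (frob (1 : Matrix (Fin 1) (Fin 1) ℝ) +
    ‖(0 : E 1)‖ + |(0 : ℝ)|))
    (Eventually.of_forall fun _ => le_rfl)).trans_lt ENNReal.ofReal_lt_top).ne

theorem memLp_of_continuous_of_isBounded {X W : Type*} [MeasurableSpace X] [PseudoMetricSpace X]
    [ProperSpace X] [OpensMeasurableSpace X] [SecondCountableTopology X] [NormedAddCommGroup W]
    {ν : Measure X} [IsFiniteMeasureOnCompacts ν] {f : X → W} (hf : Continuous f) {S : Set X}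
    (hS : Bornology.IsBounded S) (p : ℝ≥0∞) : MemLp f p (ν.restrict S) := by
  have hc : IsCompact (closure S) := hS.isCompact_closure
  obtain ⟨C, hC⟩ := hc.exists_bound_of_continuousOn hf.continuousOn
  have : IsFiniteMeasure (ν.restrict (closure S)) := ⟨by simpa using hc.measure_lt_top⟩
  have h := MemLp.of_bound (p := p) (μ := ν.restrict (closure S))
    hf.aestronglyMeasurable C
    ((ae_restrict_iff' isClosed_closure.measurableSet).2 (Eventually.of_forall hC))
  exact h.mono_measure (Measure.restrict_mono subset_closure le_rfl)

theorem tendsto_eLpNorm_zero_of_bounded {X W : Type*} [MeasurableSpace X] [NormedAddCommGroup W]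
    {ν : Measure X} [IsFiniteMeasure ν] {f : ℕ → X → W} {C : ℝ}
    (hf : ∀ k, AEStronglyMeasurable (f k) ν) (hC : ∀ k, ∀ᵐ x ∂ν, ‖f k x‖ ≤ C)
    (hlim : ∀ᵐ x ∂ν, Tendsto (fun k => f k x) atTop (𝓝 0)) :
    Tendsto (fun k => eLpNorm (f k) 2 ν) atTop (𝓝 0) := by
  have key : Tendsto (fun k => ∫⁻ x, ‖f k x‖ₑ ^ (2 : ℝ) ∂ν) atTop (𝓝 (∫⁻ _, 0 ∂ν)) := by
    refine tendsto_lintegral_of_dominated_convergence' (fun _ => ENNReal.ofReal C ^ (2 : ℝ))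
      (fun k => (hf k).enorm.pow_const _) (fun k => ?_) ?_ ?_
    · filter_upwards [hC k] with x hx
      gcongr
      rw [← ofReal_norm]
      exact ENNReal.ofReal_le_ofReal hx
    · rw [lintegral_const]
      exact ENNReal.mul_ne_top (by simp) (measure_ne_top _ _)
    · filter_upwards [hlim] with x hx
      have := (ENNReal.continuous_rpow_const (y := (2 : ℝ))).tendsto 0 |>.comp
        (by simpa using hx.enorm)
      simpa [Function.comp_def] using this
  have h2 := (ENNReal.continuous_rpow_const (y := (1 / 2 : ℝ))).tendsto 0 |>.comp
    (by simpa using key)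
  simp only [eLpNorm_eq_lintegral_rpow_enorm_toReal two_ne_zero ENNReal.ofNat_ne_top]
  simpa [Function.comp_def] using h2

theorem hasGradientAt_comp_coord {p : ℝ → ℝ} {p' : ℝ} {x : E 1} (hp : HasDerivAt p p' (x 0)) :
    HasGradientAt (fun x : E 1 => p (x 0)) (p' • unitVec) x := by
  rw [hasGradientAt_iff_hasFDerivAt]
  have h := hp.hasFDerivAt.comp x (coord.hasFDerivAt (x := x))
  have e : InnerProductSpace.toDual ℝ (E 1) (p' • unitVec) =
      (ContinuousLinearMap.toSpanSingleton ℝ p').comp coord := by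
    ext v
    simp [inner_eq_mul_coord, mul_comm]
  rw [e]
  exact h

theorem gradient_coord {ψ : E 1 → ℝ} (hψ : Differentiable ℝ ψ) (x : E 1) :
    HasDerivAt (fun y : ℝ => ψ (y • unitVec)) (gradient ψ x 0) (x 0) := by
  have h1 : HasDerivAt (fun y : ℝ => y • unitVec) unitVec (x 0) := by
    simpa using (hasDerivAt_id (x 0)).smul_const unitVec
  have h2 := (hψ (x 0 • unitVec)).hasGradientAt.hasFDerivAt.comp_hasDerivAt (x 0) h1
  rw [coord_smul_unitVec, InnerProductSpace.toDual_apply_apply, inner_eq_mul_coord, unitVec_zero,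
    mul_one] at h2
  exact h2

/-! ### Smooth functions vanishing at ±π lie in H¹. -/

section Cutoff

/-- At the argument z of `cutoff`, z + 1 = κ(π² - y²). The bound thus offsets the factor κ in the
cutoff's derivative by the distance to the boundary. It holds since the derivative is zero outside
[0,1]. -/
theorem exists_bound_deriv_smoothTransition :
    ∃ B : ℝ, 0 ≤ B ∧ ∀ z : ℝ, |deriv Real.smoothTransition z * (z + 1)| ≤ B := by
  have hc : Continuous (deriv Real.smoothTransition) :=
    (Real.smoothTransition.contDiff (n := 1)).continuous_deriv le_rfl
  obtain ⟨B, hB⟩ := (isCompact_Icc (a := (0 : ℝ)) (b := 1)).exists_bound_of_continuousOn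
    (f := fun z => deriv Real.smoothTransition z * (z + 1)) (by fun_prop)
  have hB0 : 0 ≤ B := (norm_nonneg _).trans (hB 0 (by simp))
  refine ⟨B, hB0, fun z => ?_⟩
  by_cases hz : z ∈ Icc (0 : ℝ) 1
  · exact hB z hz
  have : deriv Real.smoothTransition z = 0 := by
    rcases not_and_or.1 hz with h | h
    · have : Real.smoothTransition =ᶠ[𝓝 z] fun _ => 0 := by
        filter_upwards [Iio_mem_nhds (not_le.1 h)] with w hw
        exact Real.smoothTransition.zero_of_nonpos (le_of_lt hw)
      rw [this.deriv_eq, deriv_const]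
    · have : Real.smoothTransition =ᶠ[𝓝 z] fun _ => 1 := by
        filter_upwards [Ioi_mem_nhds (not_le.1 h)] with w hw
        exact Real.smoothTransition.one_of_one_le (le_of_lt hw)
      rw [this.deriv_eq, deriv_const]
  rw [this, zero_mul, abs_zero]
  exact hB0

/-- A smooth cutoff that vanishes near the ends of `(-π, π)` and tends to one inside. -/
def cutoff (κ y : ℝ) : ℝ := Real.smoothTransition (κ * (Real.pi ^ 2 - y ^ 2) - 1)

theorem contDiff_cutoff (κ : ℝ) : ContDiff ℝ ∞ (cutoff κ) :=
  Real.smoothTransition.contDiff.comp (by fun_prop)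

theorem hasDerivAt_cutoff (κ y : ℝ) : HasDerivAt (cutoff κ)
    (deriv Real.smoothTransition (κ * (Real.pi ^ 2 - y ^ 2) - 1) * (-2 * κ * y)) y := by
  have h1 : HasDerivAt (fun y : ℝ => κ * (Real.pi ^ 2 - y ^ 2) - 1) (-2 * κ * y) y := by
    have := ((((hasDerivAt_id' y).fun_pow 2).const_sub (Real.pi ^ 2)).const_mul κ).sub_const 1
    exact this.congr_deriv (by push_cast; ring)
  have h2 : DifferentiableAt ℝ Real.smoothTransition (κ * (Real.pi ^ 2 - y ^ 2) - 1) :=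
    (Real.smoothTransition.contDiff (n := 1)).differentiable (by simp) _
  exact h2.hasDerivAt.comp y h1

/-- The shift by -1 in `cutoff` keeps the support inside the closed set π² - y² ≥ 1/κ, away from the
ends. -/
theorem isTest_cutoff_mul {p : ℝ → ℝ} (hp : ContDiff ℝ ∞ p) {κ : ℝ} (hκ : 0 < κ) :
    IsTest interval (fun x => cutoff κ (x 0) * p (x 0)) := by
  have hs : Function.support (fun x : E 1 => cutoff κ (x 0) * p (x 0)) ⊆
      {x | 1 / κ ≤ Real.pi ^ 2 - x 0 ^ 2} := by
    intro x hx
    by_contra h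
    refine hx ?_
    have h' : Real.pi ^ 2 - x 0 ^ 2 < 1 / κ := not_le.1 h
    rw [lt_div_iff₀ hκ] at h'
    simp only [cutoff]
    rw [Real.smoothTransition.zero_of_nonpos (by linarith), zero_mul]
  have hcl : IsClosed {x : E 1 | 1 / κ ≤ Real.pi ^ 2 - x 0 ^ 2} :=
    isClosed_le continuous_const (continuous_const.sub (coord.continuous.pow 2))
  have hsub : {x : E 1 | 1 / κ ≤ Real.pi ^ 2 - x 0 ^ 2} ⊆ interval := by
    intro x hx
    have : 0 < 1 / κ := by positivity
    exact (sq_lt_sq_pi_iff _).1 (by have := mem_ofPred.1 hx; linarith)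
  have hts := closure_minimal hs hcl
  refine ⟨?_, ?_, hts.trans hsub⟩
  · exact ((contDiff_cutoff κ).mul hp).comp coord.contDiff
  · exact Metric.isCompact_of_isClosed_isBounded isClosed_closure
      ((isBounded_interval.subset hsub).subset hts)

theorem abs_le_mul_of_vanish {p : ℝ → ℝ} (hp : ContDiff ℝ 1 p) (hp1 : p Real.pi = 0)
    (hp2 : p (-Real.pi) = 0) : ∃ C : ℝ, 0 ≤ C ∧ ∀ y ∈ Ioo (-Real.pi) Real.pi,
      |p y| ≤ C * (Real.pi ^ 2 - y ^ 2) := by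
  obtain ⟨L, hL⟩ := (isCompact_Icc (a := -Real.pi) (b := Real.pi)).exists_bound_of_continuousOn
    (hp.continuous_deriv le_rfl).continuousOn
  have hπ := Real.pi_pos
  have hL0 : 0 ≤ L := (norm_nonneg _).trans (hL 0 ⟨by linarith, hπ.le⟩)
  have mv : ∀ y ∈ Icc (-Real.pi) Real.pi, ∀ z ∈ Icc (-Real.pi) Real.pi,
      |p z - p y| ≤ L * |z - y| := fun y hy z hz =>
    (convex_Icc _ _).norm_image_sub_le_of_norm_deriv_le
      (fun x _ => (hp.differentiable (by simp)) x) hL hy hz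
  -- If d is the distance to the nearer endpoint, then |p| ≤ Ld by the mean value inequality, while
  -- (π - y)(π + y) ≥ πd.
  refine ⟨L / Real.pi, by positivity, fun y hy => ?_⟩
  have hy' : y ∈ Icc (-Real.pi) Real.pi := ⟨hy.1.le, hy.2.le⟩
  have a1 := mv Real.pi ⟨by linarith, le_rfl⟩ y hy'
  have a2 := mv (-Real.pi) ⟨le_rfl, by linarith⟩ y hy'
  rw [hp1, sub_zero, abs_of_neg (sub_neg.2 hy.2)] at a1
  rw [hp2, sub_zero, sub_neg_eq_add, abs_of_pos (by linarith [hy.1] : 0 < y + Real.pi)] at a2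
  rw [div_mul_eq_mul_div, le_div_iff₀ hπ]
  rcases le_total 0 y with h | h
  · nlinarith [mul_nonneg hL0 (mul_nonneg h (by linarith [hy.2] : 0 ≤ Real.pi - y))]
  · nlinarith [mul_nonneg hL0 (mul_nonneg (neg_nonneg.2 h) (by linarith [hy.1] : 0 ≤ Real.pi + y))]

theorem eventually_cutoff {y : ℝ} (hy : y ∈ Ioo (-Real.pi) Real.pi) :
    ∀ᶠ k : ℕ in atTop, cutoff (k + 1) y = 1 ∧
      deriv Real.smoothTransition (((k : ℝ) + 1) * (Real.pi ^ 2 - y ^ 2) - 1) = 0 := by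
  have h0 : 0 < Real.pi ^ 2 - y ^ 2 := sub_pos.2 ((sq_lt_sq_pi_iff y).2 hy)
  filter_upwards [(tendsto_natCast_atTop_atTop (R := ℝ)).eventually_gt_atTop
    (2 / (Real.pi ^ 2 - y ^ 2))] with k hk
  have h1 : 1 < ((k : ℝ) + 1) * (Real.pi ^ 2 - y ^ 2) - 1 := by
    rw [div_lt_iff₀ h0] at hk
    linarith
  refine ⟨Real.smoothTransition.one_of_one_le h1.le, ?_⟩
  have : Real.smoothTransition =ᶠ[𝓝 (((k : ℝ) + 1) * (Real.pi ^ 2 - y ^ 2) - 1)] fun _ => 1 := by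
    filter_upwards [Ioi_mem_nhds h1] with w hw
    exact Real.smoothTransition.one_of_one_le (le_of_lt hw)
  rw [this.deriv_eq, deriv_const]

/-- Smooth functions that vanish at the ends of `(-π, π)` belong to `H¹`. -/
theorem memH1_comp_coord {p : ℝ → ℝ} (hp : ContDiff ℝ ∞ p) (hp1 : p Real.pi = 0)
    (hp2 : p (-Real.pi) = 0) :
    MemH1 interval (fun x => p (x 0)) (fun x => deriv p (x 0) • unitVec) := by
  have hπ := Real.pi_pos
  have hpc : Continuous p := hp.continuous
  have hp'c : Continuous (deriv p) := hp.continuous_deriv (by simp)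
  have hcoord : Continuous (fun x : E 1 => x 0) := coord.continuous
  have hfin : IsFiniteMeasure ((volume : Measure (E 1)).restrict interval) :=
    ⟨by simpa using isBounded_interval.measure_lt_top⟩
  obtain ⟨C, hC0, hC⟩ := abs_le_mul_of_vanish (hp.of_le (by simp)) hp1 hp2
  obtain ⟨B, hB0, hB⟩ := exists_bound_deriv_smoothTransition
  obtain ⟨N₀, hN₀⟩ := (isCompact_Icc (a := -Real.pi) (b := Real.pi)).exists_bound_of_continuousOn
    hpc.continuousOn
  obtain ⟨N₁, hN₁⟩ := (isCompact_Icc (a := -Real.pi) (b := Real.pi)).exists_bound_of_continuousOn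
    hp'c.continuousOn
  have hκ : ∀ k : ℕ, 0 < (k : ℝ) + 1 := fun k => by positivity
  have hχ0 : ∀ κ y, |1 - cutoff κ y| ≤ 1 := fun κ y => by
    rw [abs_le]
    have h1 := Real.smoothTransition.nonneg (κ * (Real.pi ^ 2 - y ^ 2) - 1)
    have h2 := Real.smoothTransition.le_one (κ * (Real.pi ^ 2 - y ^ 2) - 1)
    simp only [cutoff]
    constructor <;> linarith
  have hS : Continuous (deriv Real.smoothTransition) :=
    (Real.smoothTransition.contDiff (n := 1)).continuous_deriv le_rfl
  have hcc : ∀ κ, Continuous (cutoff κ) := fun κ => (contDiff_cutoff κ).continuous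
  have hmem : ∀ᵐ x ∂((volume : Measure (E 1)).restrict interval), x ∈ interval :=
    ae_restrict_mem isOpen_interval.measurableSet
  refine ⟨memLp_of_continuous_of_isBounded (hpc.comp hcoord) isBounded_interval 2,
    memLp_of_continuous_of_isBounded ((hp'c.comp hcoord).smul continuous_const)
      isBounded_interval 2,
    fun k x => cutoff (k + 1) (x 0) * p (x 0), fun k => isTest_cutoff_mul hp (hκ k), ?_, ?_⟩
  · refine tendsto_eLpNorm_zero_of_bounded (C := N₀) (fun k => ?_) (fun k => ?_) ?_
    · have := hcc (k + 1)
      exact Continuous.aestronglyMeasurable (by fun_prop)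
    · filter_upwards [hmem] with x hx
      have h1 := hN₀ (x 0) ⟨hx.1.le, hx.2.le⟩
      rw [Real.norm_eq_abs] at h1 ⊢
      rw [← one_sub_mul, abs_mul]
      nlinarith [hχ0 (k + 1) (x 0), abs_nonneg (p (x 0))]
    · filter_upwards [hmem] with x hx
      refine tendsto_const_nhds.congr' ?_
      filter_upwards [eventually_cutoff hx] with k hk
      simp [hk.1]
  · have hgrad : ∀ (k : ℕ) (x : E 1), deriv p (x 0) • unitVec -
        gradient (fun x : E 1 => cutoff (k + 1) (x 0) * p (x 0)) x =
        ((1 - cutoff (k + 1) (x 0)) * deriv p (x 0) - deriv Real.smoothTransition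
          (((k : ℝ) + 1) * (Real.pi ^ 2 - x 0 ^ 2) - 1) * (-2 * ((k : ℝ) + 1) * x 0) * p (x 0))
          • unitVec := by
      intro k x
      have hd := (hasDerivAt_cutoff ((k : ℝ) + 1) (x 0)).mul
        ((hp.differentiable (by simp)) (x 0)).hasDerivAt
      have hg := hasGradientAt_comp_coord hd
      have hg' : gradient (fun x : E 1 => cutoff (k + 1) (x 0) * p (x 0)) x = _ := hg.gradient
      rw [hg', ← sub_smul]
      congr 1
      ring
    simp only [hgrad]
    -- The cutoff's derivative grows like k, but multiplied by `p` it stays bounded because `p`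
    -- vanishes linearly at the ends. At each interior point it is eventually zero, so dominated
    -- convergence applies.
    refine tendsto_eLpNorm_zero_of_bounded (C := N₁ + B * (2 * Real.pi * C)) (fun k => ?_)
      (fun k => ?_) ?_
    · have := hcc (k + 1)
      exact Continuous.aestronglyMeasurable (by fun_prop)
    · filter_upwards [hmem] with x hx
      have h1 := hN₁ (x 0) ⟨hx.1.le, hx.2.le⟩
      have h2 := hB (((k : ℝ) + 1) * (Real.pi ^ 2 - x 0 ^ 2) - 1)
      have h3 := hC (x 0) hx
      rw [Real.norm_eq_abs] at h1
      rw [norm_eq_abs_coord]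
      simp only [PiLp.smul_apply, unitVec_zero, smul_eq_mul, mul_one]
      refine (abs_sub _ _).trans (add_le_add ?_ ?_)
      · rw [abs_mul]
        nlinarith [hχ0 (k + 1) (x 0), abs_nonneg (deriv p (x 0))]
      · set d := deriv Real.smoothTransition (((k : ℝ) + 1) * (Real.pi ^ 2 - x 0 ^ 2) - 1)
        have hpos : 0 < Real.pi ^ 2 - x 0 ^ 2 := sub_pos.2 ((sq_lt_sq_pi_iff _).2 hx)
        have hx' : |x 0| ≤ Real.pi := (abs_lt.2 hx).le
        rw [sub_add_cancel, abs_mul, abs_of_pos (mul_pos (hκ k) hpos)] at h2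
        calc |d * (-2 * ((k : ℝ) + 1) * x 0) * p (x 0)|
            = |d| * (2 * ((k : ℝ) + 1) * |x 0|) * |p (x 0)| := by
              rw [abs_mul, abs_mul, abs_mul, abs_mul, abs_of_pos (hκ k)]
              norm_num
          _ ≤ |d| * (2 * ((k : ℝ) + 1) * Real.pi) * (C * (Real.pi ^ 2 - x 0 ^ 2)) := by
              have := hκ k
              gcongr
          _ = (|d| * (((k : ℝ) + 1) * (Real.pi ^ 2 - x 0 ^ 2))) * (2 * Real.pi * C) := by ring
          _ ≤ _ := by gcongr
    · filter_upwards [hmem] with x hx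
      refine tendsto_const_nhds.congr' ?_
      filter_upwards [eventually_cutoff hx] with k hk
      simp [hk.1, hk.2]

end Cutoff

/-! ### Single-mode solutions and the lower bound. -/

theorem integral_sin_mul_eq {m : ℝ} (hm : Real.sin (m * Real.pi) = 0) (hm0 : m ≠ 0) :
    ∫ y in (-Real.pi)..Real.pi, Real.sin (m * y) ^ 2 = Real.pi := by
  rw [intervalIntegral.integral_comp_mul_left (fun y => Real.sin y ^ 2) hm0, integral_sin_sq]
  simp only [mul_neg, Real.sin_neg, hm, smul_eq_mul]
  field_simp
  ring

theorem integral_cos_mul_eq {m : ℝ} (hm : Real.sin (m * Real.pi) = 0) (hm0 : m ≠ 0) :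
    ∫ y in (-Real.pi)..Real.pi, Real.cos (m * y) ^ 2 = Real.pi := by
  rw [intervalIntegral.integral_comp_mul_left (fun y => Real.cos y ^ 2) hm0, integral_cos_sq]
  simp only [mul_neg, Real.sin_neg, hm, smul_eq_mul]
  field_simp
  ring

theorem hasDerivAt_sin_mul (m y : ℝ) :
    HasDerivAt (fun y => Real.sin (m * y)) (m * Real.cos (m * y)) y := by
  have := ((hasDerivAt_id' y).const_mul m).sin
  exact this.congr_deriv (by ring)

theorem hasDerivAt_cos_mul (m y : ℝ) :
    HasDerivAt (fun y => Real.cos (m * y)) (-(m * Real.sin (m * y))) y := by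
  have := ((hasDerivAt_id' y).const_mul m).cos
  exact this.congr_deriv (by ring)

/-- Integration by parts; `ψ` vanishes at ±π, so no boundary terms appear and `m` is arbitrary. -/
theorem integral_cos_mul_gradient {ψ : E 1 → ℝ} (hψ : IsTest interval ψ) (m : ℝ) :
    ∫ x in interval, Real.cos (m * x 0) * gradient ψ x 0 =
      m * ∫ x in interval, Real.sin (m * x 0) * ψ x := by
  set P : ℝ → ℝ := fun y => ψ (y • unitVec) with hP
  set P' : ℝ → ℝ := fun y => gradient ψ (y • unitVec) 0 with hP'
  have hd : ∀ y, HasDerivAt P (P' y) y := fun y => by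
    have := gradient_coord (hψ.1.differentiable (by simp)) (y • unitVec)
    simpa [hP'] using this
  have hP'c : Continuous P' := coord.continuous.comp
    (hψ.continuous_gradient.comp (continuous_id.smul continuous_const))
  have hend : ∀ y, y ∉ Ioo (-Real.pi) Real.pi → P y = 0 := fun y hy => by
    refine image_eq_zero_of_notMem_tsupport (f := ψ) fun h => hy ?_
    simpa [interval] using hψ.2.2 h
  have h1 : ∀ x : E 1, Real.cos (m * x 0) * gradient ψ x 0 =
      (fun y => Real.cos (m * y) * P' y) (x 0) := fun x => by
    simp only [hP', coord_smul_unitVec]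
  have h2 : ∀ x : E 1, Real.sin (m * x 0) * ψ x =
      (fun y => Real.sin (m * y) * P y) (x 0) := fun x => by
    simp only [hP, coord_smul_unitVec]
  simp only [h1, h2]
  rw [setIntegral_interval (fun y => Real.cos (m * y) * P' y),
    setIntegral_interval (fun y => Real.sin (m * y) * P y),
    intervalIntegral.integral_mul_deriv_eq_deriv_mul (fun y _ => hasDerivAt_cos_mul m y)
      (fun y _ => hd y) (Continuous.intervalIntegrable (by fun_prop) _ _)
      (hP'c.intervalIntegrable _ _),
    hend Real.pi (by simp), hend (-Real.pi) (by simp), ← intervalIntegral.integral_const_mul,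
    mul_zero, mul_zero, sub_zero, zero_sub, ← intervalIntegral.integral_neg]
  refine intervalIntegral.integral_congr fun y _ => ?_
  ring

/-- The solution of the heat equation in `(-π, π)` in a single mode. -/
theorem isSolution_sin {T δ m : ℝ} (hm : Real.sin (m * Real.pi) = 0) {a φ : ℝ → ℝ}
    (ha : ∀ s, HasDerivAt a (m * (φ s - m * a s)) s) (hφ : Continuous φ) (ha0 : a 0 = 0) :
    IsSolution (heatParams T δ) (fun s x => (-(φ s * Real.cos (m * x 0))) • unitVec)
      (fun _ _ => 0) (fun s x => a s * Real.sin (m * x 0))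
      (fun s x => (a s * (m * Real.cos (m * x 0))) • unitVec) := by
  have hac : Continuous a := continuous_iff_continuousAt.2 fun s => (ha s).continuousAt
  have hcoord : Continuous (fun x : E 1 => x 0) := coord.continuous
  have hQ : Bornology.IsBounded (Ioo 0 T ×ˢ interval) :=
    (Metric.isBounded_Ioo 0 T).prod isBounded_interval
  have hu : ∀ s, MemLp (fun x : E 1 => a s * Real.sin (m * x 0)) 2 (volume.restrict interval) :=
    fun s => memLp_of_continuous_of_isBounded (by fun_prop) isBounded_interval 2
  refine ⟨⟨?_, ?_, ?_⟩, ⟨fun s _ => hu s, ?_⟩, ?_, ?_⟩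
  · exact memLp_of_continuous_of_isBounded (by fun_prop) hQ 2
  · exact memLp_of_continuous_of_isBounded (by fun_prop) hQ 2
  · refine Eventually.of_forall fun s => ?_
    have h := memH1_comp_coord (p := fun y => a s * Real.sin (m * y)) (by fun_prop)
      (by simp [hm]) (by simp [hm])
    have hd : ∀ y, deriv (fun y => a s * Real.sin (m * y)) y = a s * (m * Real.cos (m * y)) :=
      fun y => ((hasDerivAt_sin_mul m y).const_mul (a s)).deriv
    simp only [hd] at h
    exact h
  · intro t _
    refine tendsto_nhdsWithin_of_tendsto_nhds ?_
    have hS : MemLp (fun x : E 1 => Real.sin (m * x 0)) 2 (volume.restrict interval) :=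
      memLp_of_continuous_of_isBounded (by fun_prop) isBounded_interval 2
    have e : ∀ s, eLpNorm (fun x : E 1 => a s * Real.sin (m * x 0) - a t * Real.sin (m * x 0)) 2
        (volume.restrict interval) = ‖a s - a t‖ₑ *
          eLpNorm (fun x : E 1 => Real.sin (m * x 0)) 2 (volume.restrict interval) := fun s => by
      rw [← eLpNorm_const_smul]
      congr 1
      funext x
      simp [sub_mul]
    have h0 : Tendsto (fun s => ‖a s - a t‖ₑ) (𝓝 t) (𝓝 0) := by
      have : Tendsto (fun s => a s - a t) (𝓝 t) (𝓝 0) := by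
        simpa using (hac.tendsto t).sub_const (a t)
      simpa using this.enorm
    have h1 := ENNReal.Tendsto.mul_const h0 (b := eLpNorm (fun x : E 1 => Real.sin (m * x 0)) 2
      (volume.restrict interval)) (Or.inr hS.eLpNorm_ne_top)
    rw [zero_mul] at h1
    exact h1.congr fun s => (e s).symm
  · exact Eventually.of_forall fun x => by simp [ha0]
  · intro t _ ψ hψ
    change ∫ x in interval, a t * Real.sin (m * x 0) * ψ x = ∫ s in (0 : ℝ)..t,
      ∫ x in interval, (-inner ℝ (mulVecE 1 ((a s * (m * Real.cos (m * x 0))) • unitVec))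
        (gradient ψ x) + inner ℝ (0 : E 1) ((a s * (m * Real.cos (m * x 0))) • unitVec) * ψ x +
        0 * (a s * Real.sin (m * x 0)) * ψ x -
        inner ℝ ((-(φ s * Real.cos (m * x 0))) • unitVec) (gradient ψ x) + 0 * ψ x)
    set J := ∫ x in interval, Real.sin (m * x 0) * ψ x with hJ
    -- Both flux terms are multiples of cos(mx), so every test function sees only the number `J`,
    -- and the equation reduces to the ODE for `a`.
    have inner_eq : ∀ s, ∫ x in interval,
        (-inner ℝ (mulVecE 1 ((a s * (m * Real.cos (m * x 0))) • unitVec))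
        (gradient ψ x) + inner ℝ (0 : E 1) ((a s * (m * Real.cos (m * x 0))) • unitVec) * ψ x +
        0 * (a s * Real.sin (m * x 0)) * ψ x -
        inner ℝ ((-(φ s * Real.cos (m * x 0))) • unitVec) (gradient ψ x) + 0 * ψ x) =
        (m * (φ s - m * a s)) * J := fun s => by
      rw [mul_comm m, mul_assoc, ← integral_cos_mul_gradient hψ m, ← integral_const_mul]
      congr 1
      funext x
      simp only [mulVecE_one, inner_eq_mul_coord, PiLp.smul_apply, unitVec_zero, smul_eq_mul,
        PiLp.zero_apply]
      ring
    simp only [inner_eq]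
    rw [intervalIntegral.integral_mul_const, intervalIntegral.integral_eq_sub_of_hasDerivAt
      (fun s _ => ha s) (Continuous.intervalIntegrable (by fun_prop) _ _), ha0, sub_zero, hJ,
      ← integral_const_mul]
    simp only [mul_assoc]

/-- Testing an energy estimate on a single mode. -/
theorem EnergyEstimate.sq_le_of_sin {T δ K M c₁ c₀ m : ℝ} (hT : 0 < T) (hM : 0 ≤ M)
    (h : EnergyEstimate (heatParams T δ) K M c₁ c₀) (hm : Real.sin (m * Real.pi) = 0)
    (hm0 : m ≠ 0) {a φ : ℝ → ℝ} (ha : ∀ s, HasDerivAt a (m * (φ s - m * a s)) s)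
    (hφ : Continuous φ) (ha0 : a 0 = 0) :
    Real.exp (-2 * K * T) * a T ^ 2 ≤
      c₁ * ∫ s in (0 : ℝ)..T, Real.exp (-2 * K * s) * φ s ^ 2 := by
  have hcoord : Continuous (fun x : E 1 => x 0) := coord.continuous
  have hQ : Bornology.IsBounded (Ioo 0 T ×ˢ interval) :=
    (Metric.isBounded_Ioo 0 T).prod isBounded_interval
  have hE := h _ _ (memLp_of_continuous_of_isBounded (by fun_prop) hQ 2)
    (memLp_of_continuous_of_isBounded (by fun_prop) hQ 2) _ _
    (isSolution_sin hm ha hφ ha0) T ⟨hT, le_rfl⟩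
  have e1 : ∀ s, ∫ x in interval, (a s * Real.sin (m * x 0)) ^ 2 = a s ^ 2 * Real.pi := fun s => by
    simp only [mul_pow]
    rw [integral_const_mul, setIntegral_interval (fun y => Real.sin (m * y) ^ 2),
      integral_sin_mul_eq hm hm0]
  have e2 : ∀ s, ∫ x in interval, inner ℝ ((-(φ s * Real.cos (m * x 0))) • unitVec)
      (mulVecE (1 : Matrix (Fin 1) (Fin 1) ℝ)⁻¹ ((-(φ s * Real.cos (m * x 0))) • unitVec)) =
      φ s ^ 2 * Real.pi := fun s => by
    rw [← integral_cos_mul_eq hm hm0, ← setIntegral_interval (fun y => Real.cos (m * y) ^ 2),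
      ← integral_const_mul]
    congr 1
    funext x
    simp only [inv_one, mulVecE_one, inner_eq_mul_coord, PiLp.smul_apply, unitVec_zero,
      smul_eq_mul]
    ring
  change Real.exp (-2 * K * T) * (∫ x in interval, (a T * Real.sin (m * x 0)) ^ 2) +
    M * (∫ s in (0 : ℝ)..T, Real.exp (-2 * K * s) *
      ∫ x in interval, (a s * Real.sin (m * x 0)) ^ 2) ≤
    c₁ * (∫ s in (0 : ℝ)..T, Real.exp (-2 * K * s) * ∫ x in interval,
      inner ℝ ((-(φ s * Real.cos (m * x 0))) • unitVec)
        (mulVecE (1 : Matrix (Fin 1) (Fin 1) ℝ)⁻¹ ((-(φ s * Real.cos (m * x 0))) • unitVec))) +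
    c₀ * (∫ s in (0 : ℝ)..T, Real.exp (-2 * K * s) * ∫ x in interval, (0 : ℝ) ^ 2) at hE
  simp only [e1, e2] at hE
  -- The `M` term has a favourable sign and is dropped; `c₀` plays no role because F₀ = 0.
  have e3 : 0 ≤ M * ∫ s in (0 : ℝ)..T, Real.exp (-2 * K * s) * (a s ^ 2 * Real.pi) :=
    mul_nonneg hM (intervalIntegral.integral_nonneg hT.le fun s _ => by positivity)
  simp only [← mul_assoc, intervalIntegral.integral_mul_const] at hE e3
  norm_num at hE
  norm_num at e3
  have hπ := Real.pi_pos
  have : (Real.exp (-2 * K * T) * a T ^ 2) * Real.pi ≤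
      (c₁ * ∫ s in (0 : ℝ)..T, Real.exp (-2 * K * s) * φ s ^ 2) * Real.pi := by
    norm_num
    linarith
  exact le_of_mul_le_mul_right this hπ

theorem EnergyEstimate.half_le {T δ K M c₁ c₀ : ℝ} (hT : 0 < T) (hK : 0 ≤ K) (hM : 0 ≤ M)
    (h : EnergyEstimate (heatParams T δ) K M c₁ c₀) : 1 / 2 ≤ c₁ := by
  have key : ∀ j : ℕ, 0 < j → (j : ℝ) ^ 2 - 1 / (2 * T) ≤ 2 * ((j : ℝ) ^ 2 + K) * c₁ := by
    intro j hj
    set m : ℝ := (j : ℝ) with hmdef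
    have hm0 : 0 < m := Nat.cast_pos.2 hj
    set κ := m ^ 2 + K with hκ
    have hκ0 : 0 < κ := by positivity
    have dexp : ∀ c s : ℝ, HasDerivAt (fun s : ℝ => Real.exp (c * s)) (Real.exp (c * s) * c) s :=
      fun c s => by simpa using ((hasDerivAt_id' s).const_mul c).exp
    -- After removal of the weight, the amplitude obeys ã' = mφ̃ - κã. By Cauchy–Schwarz the least
    -- costly control is proportional to the kernel e^{-κ(T-s)}, hence φ̃ = e^{κs}.
    have hle := h.sq_le_of_sin hT hM (m := m) (Real.sin_nat_mul_pi j) hm0.ne'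
      (a := fun s => m / (2 * κ) * (Real.exp ((K + κ) * s) - Real.exp ((K - κ) * s)))
      (φ := fun s => Real.exp ((K + κ) * s)) (fun s => by
        refine (((dexp (K + κ) s).sub (dexp (K - κ) s)).const_mul (m / (2 * κ))).congr_deriv ?_
        field_simp
        rw [hκ]
        ring) (by fun_prop) (by simp)
    have hint : ∫ s in (0 : ℝ)..T, Real.exp (-2 * K * s) * Real.exp ((K + κ) * s) ^ 2 =
        (Real.exp (2 * κ * T) - 1) / (2 * κ) := by
      have : ∀ s : ℝ, Real.exp (-2 * K * s) * Real.exp ((K + κ) * s) ^ 2 =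
          Real.exp (2 * κ * s) := fun s => by
        rw [← Real.exp_nat_mul, ← Real.exp_add]
        congr 1
        push_cast
        ring
      simp only [this]
      rw [intervalIntegral.integral_eq_sub_of_hasDerivAt
        (f := fun s => Real.exp (2 * κ * s) / (2 * κ))
        (fun s _ => ((dexp (2 * κ) s).div_const (2 * κ)).congr_deriv (by field_simp))
        (Continuous.intervalIntegrable (by fun_prop) _ _)]
      rw [mul_zero, Real.exp_zero, ← sub_div]
    set X := Real.exp (2 * κ * T) with hX
    have hX1 : 2 * κ * T + 1 ≤ X := Real.add_one_le_exp _
    have hX0 : 0 < X := Real.exp_pos _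
    have hlhs : Real.exp (-2 * K * T) *
        (m / (2 * κ) * (Real.exp ((K + κ) * T) - Real.exp ((K - κ) * T))) ^ 2 =
        (m / (2 * κ)) ^ 2 * ((X - 1) ^ 2 / X) := by
      have a1 : Real.exp ((K + κ) * T) = Real.exp (K * T) * Real.exp (κ * T) := by
        rw [← Real.exp_add]; congr 1; ring
      have a2 : Real.exp ((K - κ) * T) = Real.exp (K * T) / Real.exp (κ * T) := by
        rw [← Real.exp_sub]; congr 1; ring
      have a3 : Real.exp (-2 * K * T) = (Real.exp (K * T) ^ 2)⁻¹ := by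
        rw [← Real.exp_nat_mul, ← Real.exp_neg]; congr 1; push_cast; ring
      have a4 : X = Real.exp (κ * T) ^ 2 := by
        rw [← Real.exp_nat_mul, hX]; congr 1; push_cast; ring
      have p1 := Real.exp_pos (K * T)
      have p2 := Real.exp_pos (κ * T)
      rw [a1, a2, a3, a4]
      field_simp
    rw [hlhs, hint] at hle
    have hXpos : 0 < X - 1 := by
      have : 0 < 2 * κ * T := by positivity
      linarith
    have h1 : m ^ 2 * (X - 1) ≤ 2 * κ * c₁ * X := by
      have e1 : (m / (2 * κ)) ^ 2 * ((X - 1) ^ 2 / X) =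
          (m ^ 2 * (X - 1)) * ((X - 1) / (4 * κ ^ 2 * X)) := by
        field_simp
        ring
      have e2 : c₁ * ((X - 1) / (2 * κ)) = (2 * κ * c₁ * X) * ((X - 1) / (4 * κ ^ 2 * X)) := by
        field_simp
        ring
      rw [e1, e2] at hle
      exact le_of_mul_le_mul_right hle (by positivity)
    -- This bounds the defect m²/X uniformly in the mode, using X ≥ 1 + 2κT and κ ≥ m².
    have h2 : m ^ 2 ≤ 1 / (2 * T) * X := by
      rw [div_mul_eq_mul_div, le_div_iff₀ (by positivity)]
      have : m ^ 2 * (2 * T) ≤ κ * (2 * T) := by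
        gcongr
        linarith
      linarith
    have h3 : (m ^ 2 - 1 / (2 * T)) * X ≤ (2 * κ * c₁) * X := by linarith
    exact le_of_mul_le_mul_right h3 hX0
  by_contra! hc
  -- If c₁ < 1/2, then `key` bounds j²(1 - 2c₁) by a constant independent of j, which fails for
  -- large modes.
  obtain ⟨j, hj⟩ := exists_nat_gt ((2 * K * c₁ + 1 / (2 * T)) / (1 - 2 * c₁))
  have hpos : 0 < 1 - 2 * c₁ := by linarith
  rw [div_lt_iff₀ hpos] at hj
  have hk := key (j + 1) j.succ_pos
  push_cast at hk
  have hj0 : (0 : ℝ) ≤ j := Nat.cast_nonneg j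
  have : (j : ℝ) * (1 - 2 * c₁) ≤ ((j : ℝ) + 1) ^ 2 * (1 - 2 * c₁) := by
    gcongr
    nlinarith
  linarith

theorem half_le_C₁ {T δ K M : ℝ} (hT : 0 < T) (hδ : 0 < δ) (hδ1 : δ ≤ 1) (hK : 0 ≤ K)
    (hM : 0 ≤ M) : 1 / 2 ≤ C₁ K M (heatParams T δ).P := by
  refine le_sInf ?_
  rintro c ⟨c₁, c₀, -, -, rfl, h⟩
  have := (h _ (admissible_heatParams hT hδ hδ1) rfl).half_le hT hK hM
  rw [show (1 / 2 : ℝ≥0∞) = ENNReal.ofReal (1 / 2) by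
    rw [ENNReal.ofReal_div_of_pos two_pos]; simp]
  exact ENNReal.ofReal_le_ofReal this

/-- Let a increase to 1 in `C₁_le`. The `K` chosen there contains B²/(2(1-a)δ) and may blow up, so
the limit is taken under the infimum over `K`. -/
theorem iInf_C₁_le_half {T δ M : ℝ} (hδ : 0 < δ) (hM : 0 ≤ M) :
    ⨅ (K : ℝ) (_ : 0 ≤ K), C₁ K M (heatParams T δ).P ≤ 1 / 2 := by
  have hlim : Tendsto (fun a : ℝ => ENNReal.ofReal (1 / (2 * a))) (𝓝[<] 1) (𝓝 (1 / 2)) := by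
    have h1 : ContinuousAt (fun a : ℝ => ENNReal.ofReal (1 / (2 * a))) 1 :=
      ENNReal.continuous_ofReal.continuousAt.comp
        (ContinuousAt.div continuousAt_const (by fun_prop) (by norm_num))
    have h2 : ENNReal.ofReal (1 / (2 * 1)) = 1 / 2 := by
      rw [mul_one, ENNReal.ofReal_div_of_pos two_pos]; simp
    rw [← h2]
    exact tendsto_nhdsWithin_of_tendsto_nhds h1
  refine ge_of_tendsto hlim ?_
  filter_upwards [Ioo_mem_nhdsLT (show (0 : ℝ) < 1 by norm_num)] with a ha
  obtain ⟨K, hK, hle⟩ := C₁_le (bound_heatParams_ne_top T δ) (P := (heatParams T δ).P) hδ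
    ha.1 ha.2 hM
  exact (iInf₂_le K hK).trans hle

end ParabolicSharp

end

theorem theorem6 (T : ℝ) (hT : 0 < T) (δ : ℝ) (hδ : 0 < δ) (hδ1 : δ ≤ 1) (M : ℝ) (hM : 0 ≤ M) :
    (ParabolicSharp.heatParams T δ).Admissible ∧
    (⨅ (K : ℝ) (_ : 0 ≤ K), ParabolicSharp.C₁ K M (ParabolicSharp.heatParams T δ).P) = 1 / 2 :=
  ⟨ParabolicSharp.admissible_heatParams hT hδ hδ1,
    le_antisymm (ParabolicSharp.iInf_C₁_le_half hδ hM)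
      (le_iInf₂ fun _ hK => ParabolicSharp.half_le_C₁ hT hδ hδ1 hK hM)⟩
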